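/- Let $l$, $m$, $r$ be nonzero complex numbers with $m=\frac1r-r$, and let $F=\mathbb{Q}(l,r)\subseteq\mathbb{C}$. For an integer $n\geq 3$, the BMW algebra of type $A_{n-1}$ over $F$ with parameters $l$ and $m$ is the unital associative $F$-algebra generated by invertible elements $g_1,\dots,g_{n-1}$ and elements $e_1,\dots,e_{n-1}$ subject to the relations $$g_ig_j=g_jg_i\ \ (|i-j|\geq 2),\qquad g_ig_jg_i=g_jg_ig_j\ \ (|i-j|=1),$$ $$e_i=\tfrac{l}{m}\,(g_i^2+m\,g_i-1),\qquad g_ie_i=l^{-1}e_i,\qquad e_ig_je_i=l\,e_i\ \ (|i-j|=1).$$ (1) Let $n\geq 4$. If $r^{2k}=1$ for some $k\in\{2,\dots,n\}$, or if $$l\in\Big\{r,\,-r^3,\,\tfrac1{r^{n-3}},\,-\tfrac1{r^{n-3}},\,\tfrac1{r^{2n-3}},\,-r^{2n-3},\,r^{n-3},\,-r^{n-3},\,\tfrac1{r^3},\,-\tfrac1r\Big\},$$ then the BMW algebra of type $A_{n-1}$ with parameters $l$ and $m$ over $F$ is not semisimple. (2) If $r^4=1$, or $r^6=1$, or $l\in\{-r^3,\,\frac1{r^3},\,1,\,-1\}$,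 then the BMW algebra of type $A_2$ with parameters $l$ and $m$ over $F$ is not semisimple. -/

import Mathlib

/-- The symbols from which the BMW algebra with `N` nodes is presented: for each node `i`,
a generator `g i`, its inverse `ginv i`, and `e i`. -/
inductive BMWGen (N : ℕ) : Type
  | g : Fin N → BMWGen N
  | ginv : Fin N → BMWGen N
  | e : Fin N → BMWGen N

/-- Two nodes of the Dynkin diagram of type `A` are adjacent when they differ by one. -/
def BMWAdj {N : ℕ} (i j : Fin N) : Prop :=
  (i : ℕ) + 1 = (j : ℕ) ∨ (j : ℕ) + 1 = (i : ℕ)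

namespace BMWGen

/-- The letter `g i` in the free algebra. -/
abbrev G (K : Type*) [Field K] {N : ℕ} (i : Fin N) : FreeAlgebra K (BMWGen N) :=
  FreeAlgebra.ι K (BMWGen.g i)

/-- The letter `ginv i` in the free algebra. -/
abbrev Ginv (K : Type*) [Field K] {N : ℕ} (i : Fin N) : FreeAlgebra K (BMWGen N) :=
  FreeAlgebra.ι K (BMWGen.ginv i)

/-- The letter `e i` in the free algebra. -/
abbrev E (K : Type*) [Field K] {N : ℕ} (i : Fin N) : FreeAlgebra K (BMWGen N) :=
  FreeAlgebra.ι K (BMWGen.e i)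

end BMWGen

open BMWGen in
/-- The defining relations of the BMW algebra of type `A_N` with parameters `l` and `m`. -/
inductive BMWRel (K : Type*) [Field K] (l m : K) (N : ℕ) :
    FreeAlgebra K (BMWGen N) → FreeAlgebra K (BMWGen N) → Prop
  | mul_inv (i : Fin N) : BMWRel K l m N (G K i * Ginv K i) 1
  | inv_mul (i : Fin N) : BMWRel K l m N (Ginv K i * G K i) 1
  | comm (i j : Fin N) (hne : i ≠ j) (h : ¬ BMWAdj i j) :
      BMWRel K l m N (G K i * G K j) (G K j * G K i)
  | braid (i j : Fin N) (h : BMWAdj i j) :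
      BMWRel K l m N (G K i * G K j * G K i) (G K j * G K i * G K j)
  | e_eq (i : Fin N) :
      BMWRel K l m N (E K i) ((l / m) • (G K i ^ 2 + m • G K i - 1))
  | g_mul_e (i : Fin N) : BMWRel K l m N (G K i * E K i) (l⁻¹ • E K i)
  | e_g_e (i j : Fin N) (h : BMWAdj i j) :
      BMWRel K l m N (E K i * G K j * E K i) (l • E K i)

/-- The BMW algebra of type `A_{n-1}` over the field `K` with parameters `l` and `m`:
the unital associative `K`-algebra with the generators and relations above, the nodes being
`n - 1` in number. -/
abbrev BMWAlgebra (K : Type*) [Field K] (l m : K) (n : ℕ) : Type _ :=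
  RingQuot (BMWRel K l m (n - 1))

/-- The subfield `ℚ(l, r)` of `ℂ`. -/
noncomputable abbrev paramField (l r : ℂ) : IntermediateField ℚ ℂ :=
  IntermediateField.adjoin ℚ ({l, r} : Set ℂ)

theorem l_mem_paramField (l r : ℂ) : l ∈ paramField l r :=
  IntermediateField.subset_adjoin ℚ _ (by simp)

theorem r_mem_paramField (l r : ℂ) : r ∈ paramField l r :=
  IntermediateField.subset_adjoin ℚ _ (by simp)

theorem m_mem_paramField {l m r : ℂ} (h : m = 1 / r - r) : m ∈ paramField l r := by
  rw [h]
  exact sub_mem (div_mem (one_mem _) (r_mem_paramField l r)) (r_mem_paramField l r)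

/-!
The algebra is shown not to be semisimple by exhibiting modules in which some submodule has no
complement. Two families of modules suffice, over any field and for a root `r` of
`x ^ 2 + m x - 1`; since `-r⁻¹` is the other root, every parameter that is found for `r` gives a
second one, by exchanging `r` for `-r⁻¹`.

*The arc module.* The diagrams with a single arc, modulo those with more, all other strands being
acted on through `g ↦ r`, form a module with basis the arcs `(i, j)` (`isBMWFamily_arc`). It is
convenient to allow infinitely many strands. Each `e k` has rank one with image spanned by the arc
`(k, k + 1)`, and all arcs on the first `n` strands lie in the submodule generated by `(0, 1)`.
Hence an equivariant projection onto a submodule killed by all `e k` kills all these arcs, so that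
a nonzero submodule inside their span which is killed by all `e k` has no complement
(`IsSeed.not_isSemisimpleRing`). Such a submodule is grown from a small subspace, a *seed*, by
applying the generators one at a time (`IsSeed.exists_succ`). Seeds exist for
* `l = -r ^ 3`: a vector supported on three strands, on which `g 0` and `g 1` act as `-r⁻¹`;
* `l = r`: a plane supported on four strands, a Specht module of shape `(2, 2)`;
* `l ^ 2 = r ^ (6 - 2 n)` or `l = r ^ (3 - 2 n)`: the vector that is invariant under the generators
  `g 1, …, g (n - 2)`, which is killed by `e 0` precisely for these `l`.

*The Hecke algebra.* Setting all `e k` to zero gives the Hecke algebra of the symmetric group,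
which acts on functions on that group. The function `w ↦ r ^ (number of inversions of w)` spans the
trivial module. A projection onto it would express `1` as a multiple of the Poincaré polynomial
`∑ r ^ (2 * (number of inversions of w))`, which vanishes if `r ^ (2 * k) = 1` with
`2 ≤ k ≤ n` (`sum_perm_eq_zero`, `not_isSemisimpleRing_of_pow_eq_one`).
-/

/-! ### Representations of the BMW algebra given by operators -/

section Representations

variable {K : Type*} [Field K] {M : Type*} [AddCommGroup M] [Module K M]

/-- Endomorphisms `g i`, `e i` of a vector space satisfying the defining relations of the BMW
algebra with nodes `Fin N`. The inverse of `g i` is then `g i + m - m e i`, so that no third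
family of operators is needed. -/
structure IsBMWFamily (l m : K) {N : ℕ} (g e : Fin N → Module.End K M) : Prop where
  comm : ∀ i j, i ≠ j → ¬ BMWAdj i j → g i * g j = g j * g i
  braid : ∀ i j, BMWAdj i j → g i * g j * g i = g j * g i * g j
  e_eq : ∀ i, e i = (l / m) • (g i ^ 2 + m • g i - 1)
  g_mul_e : ∀ i, g i * e i = l⁻¹ • e i
  e_g_e : ∀ i j, BMWAdj i j → e i * g j * e i = l • e i

namespace IsBMWFamily

variable {l m : K} {N : ℕ} {g e : Fin N → Module.End K M}

theorem e_mul_g (h : IsBMWFamily l m g e) (i : Fin N) : e i * g i = l⁻¹ • e i := by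
  rw [← h.g_mul_e i, h.e_eq i]
  simp only [smul_mul_assoc, mul_smul_comm, sub_mul, add_mul, mul_sub, mul_add, one_mul, mul_one,
    pow_two, mul_assoc]

/-- The relation defining `e i`, solved for the square of `g i`. -/
theorem sq_eq (h : IsBMWFamily l m g e) (hl : l ≠ 0) (hm : m ≠ 0) (i : Fin N) :
    g i * g i = 1 - m • g i + (m * l⁻¹) • e i := by
  rw [h.e_eq i, smul_smul]
  have : m * l⁻¹ * (l / m) = 1 := by field_simp
  rw [this, pow_two]
  module

theorem mul_inv (h : IsBMWFamily l m g e) (hl : l ≠ 0) (hm : m ≠ 0) (i : Fin N) :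
    g i * (g i + m • 1 - m • e i) = 1 := by
  rw [mul_sub, mul_add, h.sq_eq hl hm, mul_smul_comm, mul_smul_comm, h.g_mul_e]
  simp only [mul_one]
  module

theorem inv_mul (h : IsBMWFamily l m g e) (hl : l ≠ 0) (hm : m ≠ 0) (i : Fin N) :
    (g i + m • 1 - m • e i) * g i = 1 := by
  rw [sub_mul, add_mul, h.sq_eq hl hm, smul_mul_assoc, smul_mul_assoc, h.e_mul_g]
  simp only [one_mul]
  module

/-- The image of each symbol of the presentation under the representation given by `g` and `e`. -/
def symbolMap (m : K) (g e : Fin N → Module.End K M) : BMWGen N → Module.End K M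
  | .g i => g i
  | .ginv i => g i + m • 1 - m • e i
  | .e i => e i

theorem lift_eq_of_rel (h : IsBMWFamily l m g e) (hl : l ≠ 0) (hm : m ≠ 0)
    ⦃x y : FreeAlgebra K (BMWGen N)⦄ (hxy : BMWRel K l m N x y) :
    FreeAlgebra.lift K (symbolMap m g e) x = FreeAlgebra.lift K (symbolMap m g e) y := by
  cases hxy with
  | mul_inv i => simpa [symbolMap] using h.mul_inv hl hm i
  | inv_mul i => simpa [symbolMap] using h.inv_mul hl hm i
  | comm i j hne hadj => simpa [symbolMap] using h.comm i j hne hadj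
  | braid i j hadj => simpa [symbolMap] using h.braid i j hadj
  | e_eq i => simpa [symbolMap] using h.e_eq i
  | g_mul_e i => simpa [symbolMap] using h.g_mul_e i
  | e_g_e i j hadj => simpa [symbolMap] using h.e_g_e i j hadj

/-- The representation of the BMW algebra afforded by a family of operators satisfying its
relations. -/
noncomputable def rep (h : IsBMWFamily l m g e) (hl : l ≠ 0) (hm : m ≠ 0) :
    RingQuot (BMWRel K l m N) →ₐ[K] Module.End K M :=
  RingQuot.liftAlgHom K ⟨FreeAlgebra.lift K (symbolMap m g e), h.lift_eq_of_rel hl hm⟩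

theorem rep_mk (h : IsBMWFamily l m g e) (hl : l ≠ 0) (hm : m ≠ 0)
    (x : FreeAlgebra K (BMWGen N)) :
    h.rep hl hm (RingQuot.mkAlgHom K _ x) = FreeAlgebra.lift K (symbolMap m g e) x := by
  simp [rep]

/-- A subspace stable under all `g i` and `e i` is stable under the whole algebra. -/
theorem rep_mem (h : IsBMWFamily l m g e) (hl : l ≠ 0) (hm : m ≠ 0) (U : Submodule K M)
    (hg : ∀ i, ∀ v ∈ U, g i v ∈ U) (he : ∀ i, ∀ v ∈ U, e i v ∈ U)
    (a : RingQuot (BMWRel K l m N)) : ∀ v ∈ U, h.rep hl hm a v ∈ U := by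
  obtain ⟨x, rfl⟩ := RingQuot.mkAlgHom_surjective K (BMWRel K l m N) a
  rw [rep_mk]
  induction x using FreeAlgebra.induction with
  | grade0 c => intro v hv; simpa using U.smul_mem c hv
  | grade1 s =>
    intro v hv
    rw [FreeAlgebra.lift_ι_apply]
    cases s with
    | g i => exact hg i v hv
    | ginv i =>
      simpa [symbolMap] using
        U.sub_mem (U.add_mem (hg i v hv) (U.smul_mem m hv)) (U.smul_mem m (he i v hv))
    | e i => exact he i v hv
  | mul x y hx hy => intro v hv; simpa using hx _ (hy v hv)
  | add x y hx hy => intro v hv; simpa using U.add_mem (hx v hv) (hy v hv)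

/-- Complete reducibility in terms of operators: over a semisimple BMW algebra every stable
subspace is the image of a projection that commutes with all `g i` and `e i`. -/
theorem exists_projection (h : IsBMWFamily l m g e) (hl : l ≠ 0) (hm : m ≠ 0)
    (hss : IsSemisimpleRing (RingQuot (BMWRel K l m N))) (U : Submodule K M)
    (hg : ∀ i, ∀ v ∈ U, g i v ∈ U) (he : ∀ i, ∀ v ∈ U, e i v ∈ U) :
    ∃ p : M →ₗ[K] M, (∀ v, p v ∈ U) ∧ (∀ v ∈ U, p v = v) ∧
      (∀ i v, p (g i v) = g i (p v)) ∧ ∀ i v, p (e i v) = e i (p v) := by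
  let _ : Module (RingQuot (BMWRel K l m N)) M := Module.compHom M (h.rep hl hm).toRingHom
  have hsmul : ∀ (a : RingQuot (BMWRel K l m N)) (v : M), a • v = h.rep hl hm a v :=
    fun _ _ => rfl
  let U' : Submodule (RingQuot (BMWRel K l m N)) M :=
    { U with smul_mem' := fun a v hv => h.rep_mem hl hm U hg he a v hv }
  obtain ⟨C, hC⟩ := exists_isCompl U'
  let q := U'.subtype ∘ₗ U'.projectionOnto C hC
  refine ⟨{ toFun := q, map_add' := q.map_add, map_smul' := fun c v => ?_ }, fun v => ?_,
    fun v hv => ?_, fun i v => ?_, fun i v => ?_⟩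
  · have := q.map_smul (algebraMap K _ c) v
    rw [hsmul, hsmul] at this
    simpa using this
  · exact (U'.projectionOnto C hC v).2
  · exact congrArg Subtype.val (Submodule.projectionOnto_apply_left hC ⟨v, hv⟩)
  · have := q.map_smul (RingQuot.mkAlgHom K _ (BMWGen.G K i)) v
    rw [hsmul, hsmul, rep_mk] at this
    simpa [symbolMap] using this
  · have := q.map_smul (RingQuot.mkAlgHom K _ (BMWGen.E K i)) v
    rw [hsmul, hsmul, rep_mk] at this
    simpa [symbolMap] using this

end IsBMWFamily

end Representations

/-! ### The arc module -/

section ArcModule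

variable {K : Type*} [Field K]

/-- The vector space with basis all pairs `(i, j)` of natural numbers. For `i < j` the pair stands
for the arc joining the strands `i` and `j`, numbered from `0`; the pairs with `j ≤ i` are harmless
and only serve to avoid a subtype. -/
abbrev ArcSpace (K : Type*) [Field K] : Type _ := ℕ × ℕ →₀ K

/-- The arc joining the strands `i` and `j`, as a basis vector. -/
noncomputable def arc (K : Type*) [Field K] (i j : ℕ) : ArcSpace K := Finsupp.single (i, j) 1

/-- The value of the operator `arcG` on the arc `(i, j)`. -/
noncomputable def arcGFun (l r : K) (k : ℕ) (p : ℕ × ℕ) : ArcSpace K :=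
  if ¬ p.1 < p.2 then r • arc K p.1 p.2
  else if p.1 = k ∧ p.2 = k + 1 then l⁻¹ • arc K k (k + 1)
  else if p.1 = k then r • arc K (k + 1) p.2
  else if p.2 = k then r • arc K p.1 (k + 1)
  else if p.1 = k + 1 then
    r⁻¹ • arc K k p.2 - (r⁻¹ - r) • arc K (k + 1) p.2
      + ((r⁻¹ - r) * r⁻¹ ^ 2) • arc K k (k + 1)
  else if p.2 = k + 1 then
    r⁻¹ • arc K p.1 k - (r⁻¹ - r) • arc K p.1 (k + 1)
      + ((r⁻¹ - r) * l⁻¹ * r) • arc K k (k + 1)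
  else r • arc K p.1 p.2

/-- The generator `g k` acting on arcs. This is the representation of the BMW algebra on diagrams
with one arc and all other strands acted on through `g ↦ r`, the arc `(i, j)` being divided by
`r ^ (i + j)`, which makes the coefficients independent of `i` and `j`. -/
noncomputable def arcG (l r : K) (k : ℕ) : Module.End K (ArcSpace K) :=
  Finsupp.linearCombination K (arcGFun l r k)

/-- The coefficient of the arc `(k, k + 1)` in the image of the arc `p` under `arcE`. -/
noncomputable def arcPairingFun (l r : K) (k : ℕ) (p : ℕ × ℕ) : K :=
  if ¬ p.1 < p.2 then 0
  else if p.1 = k ∧ p.2 = k + 1 then 1 - (l - l⁻¹) / (r⁻¹ - r)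
  else if p.1 = k then l * r⁻¹
  else if p.2 = k then r ^ 2
  else if p.1 = k + 1 then r⁻¹ ^ 2
  else if p.2 = k + 1 then l⁻¹ * r
  else 0

/-- The linear form `f` with `e k v = f v • arc k (k + 1)`. -/
noncomputable def arcPairing (l r : K) (k : ℕ) : ArcSpace K →ₗ[K] K :=
  Finsupp.linearCombination K (arcPairingFun l r k)

/-- The generator `e k` acting on arcs. -/
noncomputable def arcE (l r : K) (k : ℕ) : Module.End K (ArcSpace K) :=
  (arcPairing l r k).smulRight (arc K k (k + 1))

variable (l r : K)

theorem arcE_apply (k : ℕ) (v : ArcSpace K) :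
    arcE l r k v = arcPairing l r k v • arc K k (k + 1) := rfl

theorem arcG_arc (k i j : ℕ) : arcG l r k (arc K i j) = arcGFun l r k (i, j) := by
  simp [arcG, arc]

theorem arcPairing_arc (k i j : ℕ) :
    arcPairing l r k (arc K i j) = arcPairingFun l r k (i, j) := by
  simp [arcPairing, arc]

theorem arcG_self (k : ℕ) : arcG l r k (arc K k (k + 1)) = l⁻¹ • arc K k (k + 1) := by
  simp [arcG_arc, arcGFun]

theorem arcG_left {k j : ℕ} (h : k + 1 < j) :
    arcG l r k (arc K k j) = r • arc K (k + 1) j := by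
  rw [arcG_arc, arcGFun, if_neg (by simp; omega), if_neg (by simp; omega), if_pos rfl]

theorem arcG_right {k i : ℕ} (h : i < k) :
    arcG l r k (arc K i k) = r • arc K i (k + 1) := by
  rw [arcG_arc, arcGFun, if_neg (by simp; omega), if_neg (by simp), if_neg (by simp; omega),
    if_pos rfl]

theorem arcG_succ_left {k j : ℕ} (h : k + 1 < j) :
    arcG l r k (arc K (k + 1) j) = r⁻¹ • arc K k j - (r⁻¹ - r) • arc K (k + 1) j
      + ((r⁻¹ - r) * r⁻¹ ^ 2) • arc K k (k + 1) := by
  rw [arcG_arc, arcGFun, if_neg (by simp; omega), if_neg (by simp), if_neg (by simp),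
    if_neg (by simp; omega), if_pos rfl]

theorem arcG_succ_right {k i : ℕ} (h : i < k) :
    arcG l r k (arc K i (k + 1)) = r⁻¹ • arc K i k - (r⁻¹ - r) • arc K i (k + 1)
      + ((r⁻¹ - r) * l⁻¹ * r) • arc K k (k + 1) := by
  rw [arcG_arc, arcGFun, if_neg (by simp; omega), if_neg (by simp; omega),
    if_neg (by simp; omega), if_neg (by simp), if_neg (by simp; omega), if_pos rfl]

theorem arcG_other {k i j : ℕ}
    (h : ¬ i < j ∨ (i ≠ k ∧ i ≠ k + 1 ∧ j ≠ k ∧ j ≠ k + 1)) :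
    arcG l r k (arc K i j) = r • arc K i j := by
  rw [arcG_arc, arcGFun]
  by_cases hij : i < j
  · rw [if_neg (by simp; omega), if_neg (by simp; omega), if_neg (by simp; omega),
      if_neg (by simp; omega), if_neg (by simp; omega), if_neg (by simp; omega)]
  · rw [if_pos (by simp; omega)]

theorem arcPairing_self (k : ℕ) :
    arcPairing l r k (arc K k (k + 1)) = 1 - (l - l⁻¹) / (r⁻¹ - r) := by
  simp [arcPairing_arc, arcPairingFun]

theorem arcPairing_left {k j : ℕ} (h : k + 1 < j) :
    arcPairing l r k (arc K k j) = l * r⁻¹ := by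
  rw [arcPairing_arc, arcPairingFun, if_neg (by simp; omega), if_neg (by simp; omega), if_pos rfl]

theorem arcPairing_right {k i : ℕ} (h : i < k) :
    arcPairing l r k (arc K i k) = r ^ 2 := by
  rw [arcPairing_arc, arcPairingFun, if_neg (by simp; omega), if_neg (by simp),
    if_neg (by simp; omega), if_pos rfl]

theorem arcPairing_succ_left {k j : ℕ} (h : k + 1 < j) :
    arcPairing l r k (arc K (k + 1) j) = r⁻¹ ^ 2 := by
  rw [arcPairing_arc, arcPairingFun, if_neg (by simp; omega), if_neg (by simp),
    if_neg (by simp), if_neg (by simp; omega), if_pos rfl]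

theorem arcPairing_succ_right {k i : ℕ} (h : i < k) :
    arcPairing l r k (arc K i (k + 1)) = l⁻¹ * r := by
  rw [arcPairing_arc, arcPairingFun, if_neg (by simp; omega), if_neg (by simp; omega),
    if_neg (by simp; omega), if_neg (by simp), if_neg (by simp; omega), if_pos rfl]

theorem arcPairing_other {k i j : ℕ}
    (h : ¬ i < j ∨ (i ≠ k ∧ i ≠ k + 1 ∧ j ≠ k ∧ j ≠ k + 1)) :
    arcPairing l r k (arc K i j) = 0 := by
  rw [arcPairing_arc, arcPairingFun]
  by_cases hij : i < j
  · rw [if_neg (by simp; omega), if_neg (by simp; omega), if_neg (by simp; omega),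
      if_neg (by simp; omega), if_neg (by simp; omega), if_neg (by simp; omega)]
  · rw [if_pos (by simp; omega)]

/-- Endomorphisms agreeing on all arcs are equal; this includes the degenerate pairs with `j ≤ i`,
on which every `arcG` is the scalar `r`. -/
theorem arcEnd_ext {f g : Module.End K (ArcSpace K)} (h : ∀ i j, f (arc K i j) = g (arc K i j)) :
    f = g := by
  refine Finsupp.lhom_ext' fun p => LinearMap.ext_ring ?_
  exact h p.1 p.2

variable {l r}

theorem arcE_eq (hl : l ≠ 0) (hr : r ≠ 0) (hm : r⁻¹ - r ≠ 0) (k : ℕ) :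
    arcE l r k = (l / (r⁻¹ - r)) • (arcG l r k ^ 2 + (r⁻¹ - r) • arcG l r k - 1) := by
  have hm' : 1 - r ^ 2 ≠ 0 := by
    intro h; apply hm; field_simp; linear_combination h
  refine arcEnd_ext fun i j => ?_
  simp only [arcE_apply, LinearMap.smul_apply, LinearMap.sub_apply, LinearMap.add_apply, pow_two,
    Module.End.mul_apply, Module.End.one_apply]
  rcases lt_or_ge i j with hij | hij
  · by_cases hik : i = k
    · subst hik
      rcases (by omega : j = i + 1 ∨ i + 1 < j) with rfl | hj
      · simp only [arcG_self, arcPairing_self, map_smul, smul_smul]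
        match_scalars
        field_simp
        ring
      · simp (disch := omega) only [arcG_left, arcG_succ_left, arcPairing_left, map_smul, smul_smul]
        match_scalars <;> (field_simp; try ring)
    by_cases hjk : j = k
    · subst hjk
      simp (disch := omega) only [arcG_right, arcG_succ_right, arcPairing_right, map_smul]
      match_scalars <;> (field_simp; try ring)
    by_cases hik' : i = k + 1
    · subst hik'
      simp (disch := omega) only [arcG_left, arcG_succ_left, arcG_self, arcPairing_succ_left,
        map_smul, map_add, map_sub]
      match_scalars <;> (field_simp; try ring)
    by_cases hjk' : j = k + 1
    · subst hjk'
      simp (disch := omega) only [arcG_right, arcG_succ_right, arcG_self, arcPairing_succ_right,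
        map_smul, map_add, map_sub]
      match_scalars <;> (field_simp; try ring)
    · simp (disch := omega) only [arcG_other, arcPairing_other, map_smul]
      match_scalars <;> (field_simp; try ring)
  · simp (disch := omega) only [arcG_other, arcPairing_other, map_smul]
    match_scalars <;> (field_simp; try ring)

theorem arcG_mul_arcE (k : ℕ) : arcG l r k * arcE l r k = l⁻¹ • arcE l r k := by
  refine LinearMap.ext fun v => ?_
  simp only [Module.End.mul_apply, LinearMap.smul_apply, arcE_apply, map_smul, arcG_self,
    smul_smul, mul_comm]

/-- As `arcE i` has rank one, this relation amounts to the value `l` of the linear form of `arcE i` on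
`arcG j (arc i (i + 1))`. -/
theorem arcE_mul_arcG_mul_arcE (hl : l ≠ 0) (hr : r ≠ 0) (hm : r⁻¹ - r ≠ 0) {i j : ℕ}
    (h : i + 1 = j ∨ j + 1 = i) :
    arcE l r i * arcG l r j * arcE l r i = l • arcE l r i := by
  have hm' : 1 - r ^ 2 ≠ 0 := by
    intro h; apply hm; field_simp; linear_combination h
  have key : arcPairing l r i (arcG l r j (arc K i (i + 1))) = l := by
    rcases h with rfl | rfl
    · rw [arcG_right _ _ (by omega), map_smul, arcPairing_left _ _ (by omega), smul_eq_mul]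
      field_simp
    · rw [arcG_succ_left _ _ (by omega), map_add, map_sub, map_smul, map_smul, map_smul,
        arcPairing_succ_right _ _ (by omega), arcPairing_self, arcPairing_right _ _ (by omega)]
      simp only [smul_eq_mul]
      field_simp
      ring
  refine LinearMap.ext fun v => ?_
  simp only [Module.End.mul_apply, LinearMap.smul_apply, arcE_apply, map_smul, key, smul_smul]
  rw [mul_comm]

theorem arcG_comm {a b : ℕ} (h : a + 1 < b) :
    arcG l r a * arcG l r b = arcG l r b * arcG l r a := by
  refine arcEnd_ext fun i j => ?_
  simp only [Module.End.mul_apply]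
  rcases lt_or_ge i j with hij | hij
  -- Each index is compared with `a` and `b`, which makes one of the evaluation lemmas applicable.
  · rcases (by omega : i = a ∨ i = a + 1 ∨ i = b ∨ i = b + 1 ∨
        (i ≠ a ∧ i ≠ a + 1 ∧ i ≠ b ∧ i ≠ b + 1)) with hi | hi | hi | hi | hi <;>
    rcases (by omega : j = a ∨ j = a + 1 ∨ j = b ∨ j = b + 1 ∨
        (j ≠ a ∧ j ≠ a + 1 ∧ j ≠ b ∧ j ≠ b + 1)) with hj | hj | hj | hj | hj <;>
    first
    | (exfalso; omega)
    | (try subst i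
       try subst j
       simp (disch := omega) only [arcG_self, arcG_left, arcG_right, arcG_succ_left,
        arcG_succ_right, arcG_other, map_smul, map_add, map_sub]
       try module)
  · simp (disch := omega) only [arcG_other, map_smul]

theorem arcG_braid (hl : l ≠ 0) (hr : r ≠ 0) (k : ℕ) :
    arcG l r k * arcG l r (k + 1) * arcG l r k =
      arcG l r (k + 1) * arcG l r k * arcG l r (k + 1) := by
  refine arcEnd_ext fun i j => ?_
  simp only [Module.End.mul_apply]
  rcases lt_or_ge i j with hij | hij
  · rcases (by omega : i < k ∨ i = k ∨ i = k + 1 ∨ i = k + 2 ∨ k + 2 < i)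
      with hi | hi | hi | hi | hi <;>
    rcases (by omega : j < k ∨ j = k ∨ j = k + 1 ∨ j = k + 2 ∨ k + 2 < j)
      with hj | hj | hj | hj | hj <;>
    first
    | (exfalso; omega)
    | (try subst i
       try subst j
       simp (disch := omega) only [arcG_self, arcG_left, arcG_right, arcG_succ_left,
        arcG_succ_right, arcG_other, map_smul, map_add, map_sub]
       try (match_scalars <;> (field_simp; try ring)))
  · simp (disch := omega) only [arcG_other, map_smul]

end ArcModule

/-! ### Submodules killed by the cups and caps -/

section ArcModule

variable {K : Type*} [Field K] {l r : K}

theorem isBMWFamily_arc (hl : l ≠ 0) (hr : r ≠ 0) (hm : r⁻¹ - r ≠ 0) (N : ℕ) :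
    IsBMWFamily l (r⁻¹ - r) (fun i : Fin N => arcG l r i) (fun i : Fin N => arcE l r i) where
  comm i j hne hadj := by
    rcases (by unfold BMWAdj at hadj; omega : (i : ℕ) + 1 < j ∨ (j : ℕ) + 1 < i) with h | h
    · exact arcG_comm h
    · exact (arcG_comm h).symm
  braid i j hadj := by
    rcases hadj with h | h
    · simpa only [h] using arcG_braid hl hr (i : ℕ)
    · simpa only [h] using (arcG_braid hl hr (j : ℕ)).symm
  e_eq i := arcE_eq hl hr hm i
  g_mul_e i := arcG_mul_arcE i
  e_g_e i j hadj := arcE_mul_arcG_mul_arcE hl hr hm hadj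

theorem arcE_mul_arcG (hl : l ≠ 0) (hr : r ≠ 0) (hm : r⁻¹ - r ≠ 0) (k : ℕ) :
    arcE l r k * arcG l r k = l⁻¹ • arcE l r k :=
  (isBMWFamily_arc hl hr hm (k + 1)).e_mul_g (Fin.last k)

/-- On vectors killed by `e k`, the generator `g k` satisfies the quadratic Hecke relation. -/
theorem arcG_arcG_of_arcE_eq_zero (hl : l ≠ 0) (hr : r ≠ 0) (hm : r⁻¹ - r ≠ 0) {k : ℕ}
    {v : ArcSpace K} (hv : arcE l r k v = 0) :
    arcG l r k (arcG l r k v) = v - (r⁻¹ - r) • arcG l r k v := by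
  have h := LinearMap.congr_fun ((isBMWFamily_arc hl hr hm (k + 1)).sq_eq hl hm (Fin.last k)) v
  simpa [hv] using h

/-- The scalar `r` is a root of `x ^ 2 + m x - 1`, hence `e k` vanishes where `g k` acts as `r`. -/
theorem arcE_eq_zero_of_arcG_eq (hl : l ≠ 0) (hr : r ≠ 0) (hm : r⁻¹ - r ≠ 0) {k : ℕ}
    {v : ArcSpace K} (hv : arcG l r k v = r • v) : arcE l r k v = 0 := by
  rw [arcE_eq hl hr hm]
  simp only [LinearMap.smul_apply, LinearMap.sub_apply, LinearMap.add_apply, pow_two,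
    Module.End.mul_apply, Module.End.one_apply, hv, map_smul]
  match_scalars
  field_simp
  ring

theorem semiconjBy_quadratic {A : Type*} [Ring A] [Algebra K A] {x a b : A}
    (h : SemiconjBy x a b) (c d : K) :
    SemiconjBy x (c • (a ^ 2 + d • a - 1)) (c • (b ^ 2 + d • b - 1)) :=
  ((((h.pow_right 2).add_right (h.smul_right d)).sub_right (SemiconjBy.one_right x))).smul_right c

/-- The element `g i * g j` with `i`, `j` adjacent conjugates `e j` into `e i`. -/
theorem arcE_arcG_arcG (hl : l ≠ 0) (hr : r ≠ 0) (hm : r⁻¹ - r ≠ 0) {i j : ℕ}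
    (h : i + 1 = j ∨ j + 1 = i) (v : ArcSpace K) :
    arcE l r i (arcG l r j (arcG l r i v)) = arcG l r j (arcG l r i (arcE l r j v)) := by
  have hb : arcG l r i * arcG l r j * arcG l r i = arcG l r j * arcG l r i * arcG l r j := by
    rcases h with rfl | rfl
    · exact arcG_braid hl hr i
    · exact (arcG_braid hl hr j).symm
  have hc : SemiconjBy (arcG l r j * arcG l r i) (arcE l r j) (arcE l r i) := by
    have hs : SemiconjBy (arcG l r j * arcG l r i) (arcG l r j) (arcG l r i) := by
      rw [SemiconjBy, ← hb, mul_assoc]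
    rw [arcE_eq hl hr hm, arcE_eq hl hr hm]
    exact semiconjBy_quadratic (A := Module.End K (ArcSpace K)) hs _ _
  exact (LinearMap.congr_fun hc.eq v).symm

theorem arcG_apply_comm {a b : ℕ} (h : a + 1 < b ∨ b + 1 < a) (v : ArcSpace K) :
    arcG l r a (arcG l r b v) = arcG l r b (arcG l r a v) := by
  rcases h with h | h
  · exact LinearMap.congr_fun (arcG_comm (l := l) (r := r) h) v
  · exact (LinearMap.congr_fun (arcG_comm (l := l) (r := r) h) v).symm

theorem arcE_apply_arcG (hl : l ≠ 0) (hr : r ≠ 0) (hm : r⁻¹ - r ≠ 0) {a b : ℕ}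
    (h : a + 1 < b ∨ b + 1 < a) (v : ArcSpace K) :
    arcE l r a (arcG l r b v) = arcG l r b (arcE l r a v) := by
  simp only [arcE_eq hl hr hm, LinearMap.smul_apply, LinearMap.sub_apply, LinearMap.add_apply,
    pow_two, Module.End.mul_apply, Module.End.one_apply, map_smul, map_sub, map_add,
    arcG_apply_comm h]

/-- A subspace on which the first `j` generators act, on which the generators after `g j` act as
`r`, and which is killed by all `e k`; the generator `g j` itself may move it. Such a subspace is
the seed of a subrepresentation killed by all `e k`. -/
structure IsSeed (l r : K) (N j : ℕ) (U : Submodule K (ArcSpace K)) : Prop where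
  stable : ∀ k < j, k < N → ∀ v ∈ U, arcG l r k v ∈ U
  scalar : ∀ k, j < k → k < N → ∀ v ∈ U, arcG l r k v = r • v
  killed : ∀ k < N, ∀ v ∈ U, arcE l r k v = 0

/-- The family `Y i = f i (f (i + 1) (⋯ (f j U)))`, indexed by `i ≤ j + 1`. -/
theorem exists_iterated_map (j : ℕ) (U : Submodule K (ArcSpace K))
    (f : ℕ → Module.End K (ArcSpace K)) :
    ∃ Y : ℕ → Submodule K (ArcSpace K), Y (j + 1) = U ∧ ∀ i ≤ j, Y i = (Y (i + 1)).map (f i) := by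
  induction j generalizing U with
  | zero => exact ⟨fun i => if i = 0 then U.map (f 0) else U, by simp, fun i hi => by
      obtain rfl : i = 0 := by omega
      simp⟩
  | succ j ih =>
    obtain ⟨Y, hY, hY'⟩ := ih (U.map (f (j + 1)))
    refine ⟨fun i => if i ≤ j + 1 then Y i else U, by simp, fun i hi => ?_⟩
    rcases (by omega : i ≤ j ∨ i = j + 1) with h | rfl
    · simp [show i ≤ j + 1 by omega, h, hY' i h]
    · simp [hY]

/-- A seed for `j` enlarges to a seed for `j + 1`, namely to the sum of its images under the
products `g i * ⋯ * g j`: the braid relation lets `g k` pass through these products, and lets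
`e k` pass until it meets a vector that it kills. -/
theorem IsSeed.exists_succ (hl : l ≠ 0) (hr : r ≠ 0) (hm : r⁻¹ - r ≠ 0) {N j : ℕ} (hj : j < N)
    {U : Submodule K (ArcSpace K)} (hU : IsSeed l r N j U) :
    ∃ U', U ≤ U' ∧ IsSeed l r N (j + 1) U' := by
  obtain ⟨Y, hYj, hY⟩ := exists_iterated_map j U (arcG l r)
  have mem {i : ℕ} (hi : i ≤ j) {v : ArcSpace K} (hv : v ∈ Y i) :
      ∃ y ∈ Y (i + 1), arcG l r i y = v := by
    rw [hY i hi] at hv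
    exact hv
  have mk {i : ℕ} (hi : i ≤ j) {y : ArcSpace K} (hy : y ∈ Y (i + 1)) : arcG l r i y ∈ Y i := by
    rw [hY i hi]
    exact ⟨y, hy, rfl⟩
  have low : ∀ i ≤ j + 1, ∀ k, k + 1 < i → ∀ v ∈ Y i, arcG l r k v ∈ Y i := by
    intro i hi
    induction hi using Nat.decreasingInduction with
    | self => intro k hk v hv; rw [hYj] at hv ⊢; exact hU.stable k (by omega) (by omega) v hv
    | of_succ i hi ih =>
      intro k hk v hv
      obtain ⟨y, hy, rfl⟩ := mem (by omega) hv
      rw [arcG_apply_comm (Or.inl hk)]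
      exact mk (by omega) (ih k (by omega) y hy)
  have high : ∀ i ≤ j + 1, ∀ k, i < k → k ≤ j → ∀ v ∈ Y i, arcG l r k v ∈ Y i := by
    intro i hi
    induction hi using Nat.decreasingInduction with
    | self => intro k hk hk'; omega
    | of_succ i hi ih =>
      intro k hk hk' v hv
      obtain ⟨y, hy, rfl⟩ := mem (by omega) hv
      rcases (by omega : k = i + 1 ∨ i + 1 < k) with rfl | hk
      · obtain ⟨z, hz, rfl⟩ := mem hk' hy
        have := LinearMap.congr_fun (arcG_braid hl hr i) z
        simp only [Module.End.mul_apply] at this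
        rw [← this]
        exact mk (by omega) (mk hk' (low (i + 2) (by omega) i (by omega) z hz))
      · rw [arcG_apply_comm (Or.inr hk)]
        exact mk (by omega) (ih k hk hk' y hy)
  have scal : ∀ i ≤ j + 1, ∀ k, j + 1 < k → k < N → ∀ v ∈ Y i, arcG l r k v = r • v := by
    intro i hi
    induction hi using Nat.decreasingInduction with
    | self => intro k hk hk' v hv; rw [hYj] at hv; exact hU.scalar k (by omega) hk' v hv
    | of_succ i hi ih =>
      intro k hk hk' v hv
      obtain ⟨y, hy, rfl⟩ := mem (by omega) hv
      rw [arcG_apply_comm (Or.inr (by omega)), ih k hk hk' y hy, map_smul]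
  have kill : ∀ i ≤ j + 1, ∀ k < N, ∀ v ∈ Y i, arcE l r k v = 0 := by
    suffices ∀ s i, i + s = j + 1 → ∀ k < N, ∀ v ∈ Y i, arcE l r k v = 0 from
      fun i hi => this (j + 1 - i) i (by omega)
    intro s
    induction s using Nat.strong_induction_on with | _ s IH =>
    intro i his k hk v hv
    rcases (by omega : i = j + 1 ∨ i < j + 1) with rfl | hi
    · rw [hYj] at hv
      exact hU.killed k hk v hv
    · have ih := IH (s - 1) (by omega) (i + 1) (by omega)
      obtain ⟨y, hy, rfl⟩ := mem (by omega) hv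
      rcases (by omega : (i + 1 < k ∨ k + 1 < i) ∨ k = i ∨ k = i + 1 ∨ k + 1 = i)
        with h | rfl | rfl | rfl
      · rw [arcE_apply_arcG hl hr hm h.symm, ih k hk y hy, map_zero]
      · have := LinearMap.congr_fun (arcE_mul_arcG hl hr hm k) y
        simp only [Module.End.mul_apply, LinearMap.smul_apply, ih k hk y hy, smul_zero] at this
        exact this
      · rcases (by omega : i = j ∨ i < j) with rfl | hij
        · -- `g (j + 1)` acts on `U` as the unit `r`, so it may be inserted before `y`.
          rw [hYj] at hy
          have h := arcE_arcG_arcG hl hr hm (i := i + 1) (j := i) (by omega) y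
          rw [hU.scalar _ (by omega) hk y hy, hU.killed i hj y hy, map_smul, map_smul, map_zero,
            map_zero] at h
          exact (smul_eq_zero.mp h).resolve_left hr
        · -- Here `y = g (i + 1) z`, and `z`, lying two levels up, is killed by `e i`.
          obtain ⟨z, hz, rfl⟩ := mem (by omega) hy
          rw [arcE_arcG_arcG hl hr hm (by omega)]
          rw [IH (s - 2) (by omega) (i + 2) (by omega) i (by omega) z hz, map_zero, map_zero]
      · -- Since `e k y = 0`, the vector `y` lies in the image of `g k` on `Y (k + 2)`.
        have hz : arcG l r k (arcG l r k y + (r⁻¹ - r) • y) = y := by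
          rw [map_add, arcG_arcG_of_arcE_eq_zero hl hr hm (ih k hk y hy), map_smul]
          module
        have hzY : arcG l r k y + (r⁻¹ - r) • y ∈ Y (k + 1 + 1) :=
          add_mem (low _ (by omega) k (by omega) y hy) (Submodule.smul_mem _ _ hy)
        rw [← hz, arcE_arcG_arcG hl hr hm (by omega), ih (k + 1) (by omega) _ hzY, map_zero,
          map_zero]
  refine ⟨⨆ i : Fin (j + 2), Y i, ?_, ?_, ?_, ?_⟩
  · exact hYj ▸ le_iSup (fun i : Fin (j + 2) => Y i) (Fin.last (j + 1))
  · intro k hk hkN v hv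
    induction hv using Submodule.iSup_induction' with
    | zero => simp
    | add x y _ _ hx hy => rw [map_add]; exact add_mem hx hy
    | mem i v hv =>
      have le (a : ℕ) (ha : a < j + 2) : Y a ≤ ⨆ i : Fin (j + 2), Y i :=
        le_iSup (fun i : Fin (j + 2) => Y i) ⟨a, ha⟩
      obtain ⟨i, hi⟩ := i
      replace hv : v ∈ Y i := hv
      rcases (by omega : k + 1 < i ∨ k + 1 = i ∨ k = i ∨ i < k) with h | rfl | rfl | h
      · exact le i hi (low i (by omega) k h v hv)
      · exact le k (by omega) (mk (by omega) hv)
      · obtain ⟨y, hy, rfl⟩ := mem (by omega) hv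
        rw [arcG_arcG_of_arcE_eq_zero hl hr hm (kill (k + 1) (by omega) k hkN y hy)]
        exact sub_mem (le (k + 1) (by omega) hy)
          (Submodule.smul_mem _ _ (le k hi (mk (by omega) hy)))
      · exact le i hi (high i (by omega) k h (by omega) v hv)
  · intro k hk hkN v hv
    induction hv using Submodule.iSup_induction' with
    | zero => simp
    | add x y _ _ hx hy => rw [map_add, hx, hy, smul_add]
    | mem i v hv => exact scal i (by omega) k hk hkN v hv
  · intro k hkN v hv
    induction hv using Submodule.iSup_induction' with
    | zero => simp
    | add x y _ _ hx hy => rw [map_add, hx, hy, add_zero]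
    | mem i v hv => exact kill i (by omega) k hkN v hv

theorem IsSeed.exists_stable (hl : l ≠ 0) (hr : r ≠ 0) (hm : r⁻¹ - r ≠ 0) {N j : ℕ}
    {U : Submodule K (ArcSpace K)} (hU : IsSeed l r N j U) :
    ∃ U', U ≤ U' ∧ (∀ k < N, ∀ v ∈ U', arcG l r k v ∈ U') ∧
      ∀ k < N, ∀ v ∈ U', arcE l r k v = 0 := by
  induction hs : N - j generalizing j U with
  | zero => exact ⟨U, le_rfl, fun k hk => hU.stable k (by omega) hk, hU.killed⟩
  | succ s ih =>
    obtain ⟨U₁, h₁, hU₁⟩ := hU.exists_succ hl hr hm (by omega)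
    obtain ⟨U₂, h₂, hU₂⟩ := ih hU₁ (by omega)
    exact ⟨U₂, h₁.trans h₂, hU₂⟩

/-- A nonzero subspace of the arc module that is stable and killed by all `e k` has no stable
complement: the arcs on the strands `0, …, N` generate the same submodule as `arc 0 1`, which is
in the image of `e 0`. -/
theorem IsSeed.not_isSemisimpleRing (hl : l ≠ 0) (hr : r ≠ 0) (hm : r⁻¹ - r ≠ 0) {N j : ℕ}
    {U : Submodule K (ArcSpace K)} (hU : IsSeed l r N j U) (hN : 1 ≤ N) {u : ArcSpace K}
    (huU : u ∈ U) (hu : u ≠ 0)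
    (hspan : u ∈ Submodule.span K {v | ∃ i j, i < j ∧ j ≤ N ∧ v = arc K i j}) :
    ¬ IsSemisimpleRing (RingQuot (BMWRel K l (r⁻¹ - r) N)) := by
  intro hss
  obtain ⟨U', hUU', hg, he⟩ := hU.exists_stable hl hr hm
  obtain ⟨p, hpU, hp, hpg, hpe⟩ := (isBMWFamily_arc hl hr hm N).exists_projection hl hm hss U'
    (fun i => hg i i.2) (fun i v hv => by simp [he i i.2 v hv])
  have hpg' : ∀ k < N, ∀ v, p (arcG l r k v) = arcG l r k (p v) := fun k hk v => hpg ⟨k, hk⟩ v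
  -- `arc 0 1` is a multiple of `e 0 (arc 1 2)`, and `e 0` kills the image of `p`.
  have h01 : p (arc K 0 1) = 0 := by
    have h := hpe ⟨0, hN⟩ (arc K 1 2)
    rw [he 0 hN _ (hpU _)] at h
    simp only [arcE_apply] at h
    rw [arcPairing_succ_left _ _ (by omega), map_smul] at h
    exact (smul_eq_zero.mp h).resolve_left (by simpa using hr)
  have hstep {i : ℕ} (hi : i + 1 ≤ N) (h : p (arc K i (i + 1)) = 0) :
      ∀ j, i < j → j ≤ N → p (arc K i j) = 0 := by
    intro j hij
    induction j, hij using Nat.le_induction with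
    | base => intro _; exact h
    | succ j hij ih =>
      intro hj
      have h' := hpg' j (by omega) (arc K i j)
      rw [arcG_right _ _ (by omega), ih (by omega), map_zero, map_smul] at h'
      exact (smul_eq_zero.mp h').resolve_left hr
  have hdiag : ∀ i, i + 1 ≤ N → p (arc K i (i + 1)) = 0 := by
    intro i
    induction i with
    | zero => intro _; exact h01
    | succ i ih =>
      intro hi
      have h' := hpg' i (by omega) (arc K i (i + 2))
      rw [arcG_left _ _ (by omega), hstep (by omega) (ih (by omega)) _ (by omega) hi, map_zero,
        map_smul] at h'
      exact (smul_eq_zero.mp h').resolve_left hr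
  have hzero : Submodule.span K {v | ∃ i j, i < j ∧ j ≤ N ∧ v = arc K i j} ≤ p.ker := by
    rw [Submodule.span_le]
    rintro _ ⟨i, j, hij, hj, rfl⟩
    exact hstep (by omega) (hdiag i (by omega)) j hij hj
  exact hu ((hp u (hUU' huU)).symm.trans (hzero hspan))

end ArcModule

/-! ### Seeds supported on three and four strands -/

section Seeds

variable {K : Type*} [Field K] {l r : K}

theorem mem_span_arc {N i j : ℕ} (hij : i < j) (hj : j ≤ N) :
    arc K i j ∈ Submodule.span K {v | ∃ i j, i < j ∧ j ≤ N ∧ v = arc K i j} :=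
  Submodule.subset_span ⟨i, j, hij, hj, rfl⟩

theorem arcE_eq_zero_of_arcG_eq_neg_inv (hl : l ≠ 0) (hr : r ≠ 0) (hm : r⁻¹ - r ≠ 0) {k : ℕ}
    {v : ArcSpace K} (hv : arcG l r k v = (-r⁻¹) • v) : arcE l r k v = 0 := by
  rw [arcE_eq hl hr hm]
  simp only [LinearMap.smul_apply, LinearMap.sub_apply, LinearMap.add_apply, pow_two,
    Module.End.mul_apply, Module.End.one_apply, hv, map_smul]
  match_scalars
  field_simp
  ring

theorem arc_apply (i j a b : ℕ) : arc K i j (a, b) = if i = a ∧ j = b then 1 else 0 := by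
  simp [arc, Finsupp.single_apply]

theorem not_isSemisimpleRing_of_eq_neg_cube (hr : r ≠ 0) (hm : r⁻¹ - r ≠ 0) (hlr : l = -r ^ 3)
    {N : ℕ} (hN : 2 ≤ N) : ¬ IsSemisimpleRing (RingQuot (BMWRel K l (r⁻¹ - r) N)) := by
  have hl : l ≠ 0 := by rw [hlr]; exact neg_ne_zero.mpr (pow_ne_zero 3 hr)
  -- The alternating combination on three strands; `l = -r ^ 3` makes it an eigenvector.
  set u : ArcSpace K := arc K 0 1 - arc K 0 2 + arc K 1 2 with hu
  have g0 : arcG l r 0 u = (-r⁻¹) • u := by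
    simp (disch := omega) only [hu, map_add, map_sub, arcG_self, arcG_left]
    rw [arcG_succ_left (k := 0) _ _ (by omega), hlr]
    match_scalars <;> (field_simp; try ring)
  have g1 : arcG l r 1 u = (-r⁻¹) • u := by
    simp (disch := omega) only [hu, map_add, map_sub, arcG_right]
    rw [arcG_self (k := 1), arcG_succ_right (k := 1) _ _ (by omega), hlr]
    match_scalars <;> (field_simp; try ring)
  have gk : ∀ k, 2 < k → arcG l r k u = r • u := fun k hk => by
    simp (disch := omega) only [hu, map_add, map_sub, arcG_other, smul_add, smul_sub]
  have e0 : arcE l r 0 u = 0 := arcE_eq_zero_of_arcG_eq_neg_inv hl hr hm g0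
  have e1 : arcE l r 1 u = 0 := arcE_eq_zero_of_arcG_eq_neg_inv hl hr hm g1
  have e2 : arcE l r 2 u = 0 := by
    simp (disch := omega) only [hu, map_add, map_sub, arcE_apply, arcPairing_right,
      arcPairing_other]
    simp
  have seed : IsSeed l r N 2 (K ∙ u) := by
    constructor
    · intro k hk _ v hv
      obtain ⟨c, rfl⟩ := Submodule.mem_span_singleton.mp hv
      rw [map_smul]
      refine Submodule.smul_mem _ _ ?_
      rcases (by omega : k = 0 ∨ k = 1) with rfl | rfl
      · rw [g0]; exact Submodule.smul_mem _ _ (Submodule.mem_span_singleton_self u)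
      · rw [g1]; exact Submodule.smul_mem _ _ (Submodule.mem_span_singleton_self u)
    · intro k hk _ v hv
      obtain ⟨c, rfl⟩ := Submodule.mem_span_singleton.mp hv
      rw [map_smul, gk k hk, smul_comm]
    · intro k _ v hv
      obtain ⟨c, rfl⟩ := Submodule.mem_span_singleton.mp hv
      rw [map_smul]
      rcases (by omega : k = 0 ∨ k = 1 ∨ k = 2 ∨ 2 < k) with rfl | rfl | rfl | hk
      · rw [e0, smul_zero]
      · rw [e1, smul_zero]
      · rw [e2, smul_zero]
      · rw [arcE_eq_zero_of_arcG_eq hl hr hm (gk k hk), smul_zero]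
  refine seed.not_isSemisimpleRing hl hr hm (by omega) (Submodule.mem_span_singleton_self u) ?_ ?_
  · intro h
    have := DFunLike.congr_fun h (0, 1)
    simp [hu, arc_apply] at this
  · exact add_mem (sub_mem (mem_span_arc (by omega) (by omega))
      (mem_span_arc (by omega) (by omega))) (mem_span_arc (by omega) (by omega))

theorem not_isSemisimpleRing_of_eq (hr : r ≠ 0) (hm : r⁻¹ - r ≠ 0) (hlr : l = r)
    {N : ℕ} (hN : 3 ≤ N) : ¬ IsSemisimpleRing (RingQuot (BMWRel K l (r⁻¹ - r) N)) := by
  subst hlr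
  have hm' : 1 - l ^ 2 ≠ 0 := by
    intro h; apply hm; field_simp; linear_combination h
  -- `u` is the polytabloid with columns `{0, 1}` and `{2, 3}`, and `u'` is its image under `g 1`.
  set u : ArcSpace K := arc K 0 2 - arc K 1 2 - arc K 0 3 + arc K 1 3 with hu
  set u' : ArcSpace K := l⁻¹ • arc K 0 1 + (l - l⁻¹) • arc K 0 2 - l • arc K 1 2 - l • arc K 0 3
    + l • arc K 2 3 with hu'
  -- Instances of the evaluation lemmas with the numerals `k + 1` normalised.
  have l0 (j) (h : 1 < j) := arcG_succ_left l l (k := 0) h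
  have r1 (i) (h : i < 1) := arcG_succ_right l l (k := 1) h
  have r2 (i) (h : i < 2) := arcG_succ_right l l (k := 2) h
  have s0 := arcG_self l l 0
  have s1 := arcG_self l l 1
  have s2 := arcG_self l l 2
  have pl0 (j) (h : 1 < j) := arcPairing_succ_left l l (k := 0) h
  have pr1 (i) (h : i < 1) := arcPairing_succ_right l l (k := 1) h
  have pr2 (i) (h : i < 2) := arcPairing_succ_right l l (k := 2) h
  have ps0 := arcPairing_self l l 0
  have ps1 := arcPairing_self l l 1
  have ps2 := arcPairing_self l l 2
  simp only [Nat.reduceAdd] at l0 r1 r2 s0 s1 s2 pl0 pr1 pr2 ps0 ps1 ps2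
  have g0 : arcG l l 0 u = (-l⁻¹) • u := by
    simp (disch := omega) only [hu, map_add, map_sub, arcG_left, l0]
    match_scalars <;> (field_simp; try ring)
  have g1 : arcG l l 1 u = u' := by
    simp (disch := omega) only [hu, hu', map_add, map_sub, arcG_left, r1, s1, arcG_other]
    match_scalars <;> (field_simp; try ring)
  have g2 : arcG l l 2 u = (-l⁻¹) • u := by
    simp (disch := omega) only [hu, map_add, map_sub, arcG_right, r2]
    match_scalars <;> (field_simp; try ring)
  have g0' : arcG l l 0 u' = l • u' - l ^ 2 • u := by
    simp (disch := omega) only [hu, hu', map_add, map_sub, map_smul, arcG_left, l0, s0, arcG_other]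
    match_scalars <;> (field_simp; try ring)
  have g2' : arcG l l 2 u' = l • u' - l ^ 2 • u := by
    simp (disch := omega) only [hu, hu', map_add, map_sub, map_smul, arcG_right, r2, s2,
      arcG_other]
    match_scalars <;> (field_simp; try ring)
  have gk : ∀ k, 3 < k → arcG l l k u = l • u := fun k hk => by
    simp (disch := omega) only [hu, map_add, map_sub, arcG_other, smul_add, smul_sub]
  have gk' : ∀ k, 3 < k → arcG l l k u' = l • u' := fun k hk => by
    rw [← g1, arcG_apply_comm (by omega), gk k hk, map_smul]
  have e0 : arcE l l 0 u = 0 := by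
    simp (disch := omega) only [hu, map_add, map_sub, arcE_apply, arcPairing_left, pl0]
    match_scalars
    field_simp
    ring
  have e1 : arcE l l 1 u = 0 := by
    simp (disch := omega) only [hu, map_add, map_sub, arcE_apply, arcPairing_left, pr1, ps1,
      arcPairing_other]
    match_scalars
    field_simp
    ring
  have e2 : arcE l l 2 u = 0 := by
    simp (disch := omega) only [hu, map_add, map_sub, arcE_apply, arcPairing_right, pr2]
    match_scalars
    field_simp
    ring
  have e3 : arcE l l 3 u = 0 := by
    simp (disch := omega) only [hu, map_add, map_sub, arcE_apply, arcPairing_right,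
      arcPairing_other]
    match_scalars
    field_simp
    ring
  have e0' : arcE l l 0 u' = 0 := by
    simp (disch := omega) only [hu', map_add, map_sub, map_smul, arcE_apply, arcPairing_left, pl0,
      ps0, arcPairing_other]
    match_scalars
    field_simp
    ring
  have e1' : arcE l l 1 u' = 0 := by
    have h := LinearMap.congr_fun (arcE_mul_arcG hr hr hm 1) u
    simpa [g1, e1] using h
  have e2' : arcE l l 2 u' = 0 := by
    simp (disch := omega) only [hu', map_add, map_sub, map_smul, arcE_apply, arcPairing_right, pr2,
      ps2, arcPairing_other]
    match_scalars
    field_simp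
    ring
  have e3' : arcE l l 3 u' = 0 := by
    simp (disch := omega) only [hu', map_add, map_sub, map_smul, arcE_apply, arcPairing_right,
      arcPairing_other]
    match_scalars
    field_simp
    ring
  have mem : u ∈ Submodule.span K {u, u'} := Submodule.subset_span (by simp)
  have mem' : u' ∈ Submodule.span K {u, u'} := Submodule.subset_span (by simp)
  have g1' : arcG l l 1 u' = u - (l⁻¹ - l) • u' := by
    rw [← g1]; exact arcG_arcG_of_arcE_eq_zero hr hr hm e1
  have seed : IsSeed l l N 3 (Submodule.span K {u, u'}) := by
    constructor
    · intro k hk _ v hv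
      obtain ⟨a, b, rfl⟩ := Submodule.mem_span_pair.mp hv
      rw [map_add, map_smul, map_smul]
      refine add_mem (Submodule.smul_mem _ _ ?_) (Submodule.smul_mem _ _ ?_) <;>
      rcases (by omega : k = 0 ∨ k = 1 ∨ k = 2) with rfl | rfl | rfl
      · rw [g0]; exact Submodule.smul_mem _ _ mem
      · rwa [g1]
      · rw [g2]; exact Submodule.smul_mem _ _ mem
      · rw [g0']; exact sub_mem (Submodule.smul_mem _ _ mem') (Submodule.smul_mem _ _ mem)
      · rw [g1']; exact sub_mem mem (Submodule.smul_mem _ _ mem')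
      · rw [g2']; exact sub_mem (Submodule.smul_mem _ _ mem') (Submodule.smul_mem _ _ mem)
    · intro k hk _ v hv
      obtain ⟨a, b, rfl⟩ := Submodule.mem_span_pair.mp hv
      rw [map_add, map_smul, map_smul, gk k hk, gk' k hk, smul_comm a l, smul_comm b l,
        ← smul_add]
    · intro k _ v hv
      obtain ⟨a, b, rfl⟩ := Submodule.mem_span_pair.mp hv
      rw [map_add, map_smul, map_smul]
      rcases (by omega : k = 0 ∨ k = 1 ∨ k = 2 ∨ k = 3 ∨ 3 < k) with rfl | rfl | rfl | rfl | hk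
      · rw [e0, e0', smul_zero, smul_zero, add_zero]
      · rw [e1, e1', smul_zero, smul_zero, add_zero]
      · rw [e2, e2', smul_zero, smul_zero, add_zero]
      · rw [e3, e3', smul_zero, smul_zero, add_zero]
      · rw [arcE_eq_zero_of_arcG_eq hr hr hm (gk k hk),
          arcE_eq_zero_of_arcG_eq hr hr hm (gk' k hk), smul_zero, smul_zero, add_zero]
  refine seed.not_isSemisimpleRing hr hr hm (by omega) mem ?_ ?_
  · intro h
    have := DFunLike.congr_fun h (0, 2)
    simp [hu, arc_apply] at this
  · exact add_mem (sub_mem (sub_mem (mem_span_arc (by omega) (by omega))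
      (mem_span_arc (by omega) (by omega))) (mem_span_arc (by omega) (by omega)))
      (mem_span_arc (by omega) (by omega))

end Seeds

/-! ### The seed invariant under all generators but the first -/

section Stars

open Finset

variable {K : Type*} [Field K] {l r : K}

/-- The weighted sum of the arcs that join the strand `i` to a later one, among `n` strands. The
weights are those which make `x • arc i k + y • arc i (k + 1)` an eigenvector of `g k` with
eigenvalue `r`, up to a multiple of `arc k (k + 1)`. -/
noncomputable def arcStar (r : K) (n i : ℕ) : ArcSpace K :=
  ∑ j ∈ Ico (i + 1) n, (r ^ 2) ^ j • arc K i j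

/-- A geometric sum, multiplied by `r⁻¹ - r` so that no division is needed. -/
theorem geom_sum_Ico_eq (hr : r ≠ 0) {a b : ℕ} (hab : a ≤ b) :
    (r⁻¹ - r) * ∑ j ∈ Ico a b, (r ^ 2) ^ j = r⁻¹ * ((r ^ 2) ^ a - (r ^ 2) ^ b) := by
  induction b, hab using Nat.le_induction with
  | base => simp
  | succ b hab ih =>
    rw [sum_Ico_succ_top hab, mul_add, ih]
    field_simp
    ring

/-- Isolates two consecutive terms of a sum: those at the two strands that `g k` moves. -/
theorem sum_Ico_pair {A : Type*} [AddCommMonoid A] (f : ℕ → A) {a k b : ℕ} (hak : a ≤ k)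
    (hkb : k + 1 < b) :
    ∑ j ∈ Ico a b, f j = ∑ j ∈ Ico a k, f j + (f k + (f (k + 1) + ∑ j ∈ Ico (k + 2) b, f j)) := by
  rw [← sum_Ico_consecutive f hak (by omega : k ≤ b),
    sum_eq_sum_Ico_succ_bot (by omega : k < b), sum_eq_sum_Ico_succ_bot hkb]

theorem arcG_arcStar_of_lt {n k i : ℕ} (h : k + 1 < i) :
    arcG l r k (arcStar r n i) = r • arcStar r n i := by
  rw [arcStar, map_sum, smul_sum]
  refine sum_congr rfl fun j hj => ?_
  rw [mem_Ico] at hj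
  rw [map_smul, arcG_other _ _ (by omega), smul_comm]

theorem arcG_arcStar_of_gt (hr : r ≠ 0) {n k i : ℕ} (h : i < k) (hk : k + 1 < n) :
    arcG l r k (arcStar r n i) = r • arcStar r n i +
      ((r⁻¹ - r) * l⁻¹ * r * (r ^ 2) ^ (k + 1)) • arc K k (k + 1) := by
  have hs (s : Finset ℕ) (hs : ∀ j ∈ s, j ≠ k ∧ j ≠ k + 1) :
      arcG l r k (∑ j ∈ s, (r ^ 2) ^ j • arc K i j) = r • ∑ j ∈ s, (r ^ 2) ^ j • arc K i j := by
    rw [map_sum, smul_sum]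
    refine sum_congr rfl fun j hj => ?_
    rw [map_smul, arcG_other _ _ (by have := hs j hj; omega), smul_comm]
  rw [arcStar, sum_Ico_pair _ (by omega : i + 1 ≤ k) hk]
  simp only [map_add, map_smul]
  rw [hs _ (fun j hj => by rw [mem_Ico] at hj; omega),
    hs _ (fun j hj => by rw [mem_Ico] at hj; omega), arcG_right _ _ h, arcG_succ_right _ _ h]
  match_scalars <;> (field_simp; try ring)

theorem arcG_arcStar_self {n k : ℕ} (hk : k + 1 < n) :
    arcG l r k (arcStar r n k) =
      (l⁻¹ * (r ^ 2) ^ (k + 1)) • arc K k (k + 1) + r • arcStar r n (k + 1) := by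
  rw [arcStar, arcStar, sum_eq_sum_Ico_succ_bot hk, map_add, map_smul, arcG_self, map_sum, smul_sum,
    smul_smul, mul_comm l⁻¹]
  congr 1
  refine sum_congr rfl fun j hj => ?_
  rw [mem_Ico] at hj
  rw [map_smul, arcG_left _ _ (by omega), smul_comm]

theorem arcG_arcStar_succ (hr : r ≠ 0) {n k : ℕ} (hk : k + 1 < n) :
    arcG l r k (arcStar r n (k + 1)) =
      r⁻¹ • arcStar r n k - (r⁻¹ - r) • arcStar r n (k + 1) -
        (r⁻¹ * (r ^ 2) ^ (k + 1) -
          r⁻¹ ^ 3 * ((r ^ 2) ^ (k + 2) - (r ^ 2) ^ n)) • arc K k (k + 1) := by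
  have h : arcG l r k (arcStar r n (k + 1)) =
      r⁻¹ • (∑ j ∈ Ico (k + 1 + 1) n, (r ^ 2) ^ j • arc K k j) - (r⁻¹ - r) • arcStar r n (k + 1)
      + (r⁻¹ ^ 2 * ((r⁻¹ - r) * ∑ j ∈ Ico (k + 2) n, (r ^ 2) ^ j)) • arc K k (k + 1) := by
    rw [arcStar, map_sum, smul_sum, smul_sum, mul_sum, mul_sum, sum_smul, ← sum_sub_distrib,
      ← sum_add_distrib]
    refine sum_congr rfl fun j hj => ?_
    rw [mem_Ico] at hj
    rw [map_smul, arcG_succ_left _ _ (by omega)]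
    module
  rw [h, geom_sum_Ico_eq hr (by omega), arcStar.eq_1 r n k, sum_eq_sum_Ico_succ_bot hk]
  match_scalars <;> (field_simp; try ring)

theorem arcPairing_arcStar_zero {n : ℕ} (hn : 1 < n) :
    arcPairing l r 0 (arcStar r n 0) =
      r ^ 2 * (1 - (l - l⁻¹) / (r⁻¹ - r)) + l * r⁻¹ * ∑ j ∈ Ico 2 n, (r ^ 2) ^ j := by
  rw [arcStar, sum_eq_sum_Ico_succ_bot hn, map_add, map_smul, arcPairing_self, map_sum, mul_sum]
  congr 1
  · simp
  · refine sum_congr rfl fun j hj => ?_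
    rw [mem_Ico] at hj
    rw [map_smul, arcPairing_left _ _ (by omega), smul_eq_mul, mul_comm]

theorem arcPairing_arcStar_one {n : ℕ} :
    arcPairing l r 0 (arcStar r n 1) = r⁻¹ ^ 2 * ∑ j ∈ Ico 2 n, (r ^ 2) ^ j := by
  rw [arcStar, map_sum, mul_sum]
  refine sum_congr rfl fun j hj => ?_
  rw [mem_Ico] at hj
  rw [map_smul, arcPairing_succ_left _ _ (by omega), smul_eq_mul, mul_comm]

theorem arcPairing_arcStar_of_lt {n i : ℕ} (hi : 1 < i) : arcPairing l r 0 (arcStar r n i) = 0 := by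
  rw [arcStar, map_sum]
  refine sum_eq_zero fun j hj => ?_
  rw [mem_Ico] at hj
  rw [map_smul, arcPairing_other _ _ (by omega), smul_zero]

theorem arcStar_mem {N i : ℕ} :
    arcStar r (N + 1) i ∈ Submodule.span K {v | ∃ i j, i < j ∧ j ≤ N ∧ v = arc K i j} := by
  refine sum_mem fun j hj => Submodule.smul_mem _ _ ?_
  rw [mem_Ico] at hj
  exact mem_span_arc (by omega) (by omega)

theorem arcStar_apply {n i : ℕ} (hn : 2 < n) :
    arcStar r n i (1, 2) = if i = 1 then (r ^ 2) ^ 2 else 0 := by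
  rw [arcStar, Finsupp.finsetSum_apply]
  simp only [Finsupp.smul_apply, arc_apply, smul_eq_mul]
  split_ifs with hi
  · subst hi
    rw [sum_eq_single 2] <;> (simp [hn]; try omega)
  · simp [hi]

/-- With `X = r ^ (2 n - 3)` and `n = N + 1` strands, the condition is
`(l ^ 2 * X - r ^ 3) * (1 - l * X) = 0`. -/
theorem not_isSemisimpleRing_of_star (hl : l ≠ 0) (hr : r ≠ 0) (hm : r⁻¹ - r ≠ 0)
    {N : ℕ} (hN : 2 ≤ N)
    (hlr : (l ^ 2 * ((r ^ 2) ^ (N + 1) * r⁻¹ ^ 3) - r ^ 3) *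
      (1 - l * ((r ^ 2) ^ (N + 1) * r⁻¹ ^ 3)) = 0) :
    ¬ IsSemisimpleRing (RingQuot (BMWRel K l (r⁻¹ - r) N)) := by
  have hm' : 1 - r ^ 2 ≠ 0 := by
    intro h; apply hm; field_simp; linear_combination h
  -- Up to scalars, `u` is the only combination of `arcStar 0` and the invariant sum `B` of the other
  -- stars in which the contributions of `arc k (k + 1)` to `g k u` cancel for all `0 < k < N`.
  set B : ArcSpace K := ∑ i ∈ Ico 1 (N + 1), (r ^ 2) ^ i • arcStar r (N + 1) i with hB
  set u : ArcSpace K := (r ^ 2 - l * ((r ^ 2) ^ (N + 1) * r⁻¹ ^ 3)) • arcStar r (N + 1) 0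
    + (r ^ 2 - 1) • B with hu
  have gk : ∀ k, 0 < k → k < N → arcG l r k u = r • u := by
    intro k hk hkN
    have hlow : arcG l r k (∑ i ∈ Ico 1 k, (r ^ 2) ^ i • arcStar r (N + 1) i) =
        r • (∑ i ∈ Ico 1 k, (r ^ 2) ^ i • arcStar r (N + 1) i) +
        (l⁻¹ * r * (r ^ 2) ^ (k + 1) * ((r⁻¹ - r) * ∑ i ∈ Ico 1 k, (r ^ 2) ^ i)) •
          arc K k (k + 1) := by
      rw [map_sum, smul_sum, mul_sum, mul_sum, sum_smul, ← sum_add_distrib]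
      refine sum_congr rfl fun i hi => ?_
      rw [mem_Ico] at hi
      rw [map_smul, arcG_arcStar_of_gt hr (by omega) (by omega)]
      module
    have hhigh : arcG l r k (∑ i ∈ Ico (k + 2) (N + 1), (r ^ 2) ^ i • arcStar r (N + 1) i) =
        r • (∑ i ∈ Ico (k + 2) (N + 1), (r ^ 2) ^ i • arcStar r (N + 1) i) := by
      rw [map_sum, smul_sum]
      refine sum_congr rfl fun i hi => ?_
      rw [mem_Ico] at hi
      rw [map_smul, arcG_arcStar_of_lt (by omega), smul_comm]
    rw [geom_sum_Ico_eq hr (by omega)] at hlow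
    rw [hu, hB, sum_Ico_pair _ (by omega : 1 ≤ k) (by omega : k + 1 < N + 1)]
    simp only [map_add, map_smul, hlow, hhigh]
    rw [arcG_arcStar_of_gt hr hk (by omega), arcG_arcStar_self (by omega),
      arcG_arcStar_succ hr (by omega)]
    match_scalars <;> (field_simp; try ring)
  -- The linear form of `e 0` takes on `u` the product in `hlr` as value, up to a unit.
  have e0 : arcE l r 0 u = 0 := by
    have hf : arcPairing l r 0 B = ∑ j ∈ Ico 2 (N + 1), (r ^ 2) ^ j := by
      rw [hB, sum_eq_sum_Ico_succ_bot (by omega), map_add, map_smul, arcPairing_arcStar_one, map_sum,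
        sum_eq_zero (s := Ico (1 + 1) (N + 1)), smul_eq_mul, add_zero]
      · field_simp
      · intro i hi
        rw [mem_Ico] at hi
        rw [map_smul, arcPairing_arcStar_of_lt (by omega), smul_zero]
    have hgeom := geom_sum_Ico_eq hr (by omega : 2 ≤ N + 1)
    rw [arcE_apply, hu, map_add, map_smul, map_smul, arcPairing_arcStar_zero (by omega), hf]
    have hS : ∑ j ∈ Ico 2 (N + 1), (r ^ 2) ^ j =
        (r⁻¹ - r)⁻¹ * (r⁻¹ * ((r ^ 2) ^ 2 - (r ^ 2) ^ (N + 1))) := by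
      rw [← hgeom, inv_mul_cancel_left₀ hm]
    rw [hS]
    convert zero_smul K _
    simp only [smul_eq_mul]
    generalize (r ^ 2) ^ (N + 1) = X at hlr ⊢
    field_simp
    field_simp at hlr
    linear_combination -hlr
  have seed : IsSeed l r N 0 (K ∙ u) := by
    constructor
    · intro k hk
      omega
    · intro k hk hkN v hv
      obtain ⟨c, rfl⟩ := Submodule.mem_span_singleton.mp hv
      rw [map_smul, gk k hk hkN, smul_comm]
    · intro k hkN v hv
      obtain ⟨c, rfl⟩ := Submodule.mem_span_singleton.mp hv
      rw [map_smul]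
      rcases Nat.eq_zero_or_pos k with rfl | hk
      · rw [e0, smul_zero]
      · rw [arcE_eq_zero_of_arcG_eq hl hr hm (gk k hk hkN), smul_zero]
  refine seed.not_isSemisimpleRing hl hr hm (by omega) (Submodule.mem_span_singleton_self u) ?_ ?_
  · intro h
    have := DFunLike.congr_fun h (1, 2)
    rw [hu, hB, Finsupp.add_apply, Finsupp.smul_apply, Finsupp.smul_apply,
      Finsupp.finsetSum_apply, arcStar_apply (by omega), sum_eq_single 1] at this
    · simp [arcStar_apply (by omega : 2 < N + 1), hr] at this
      exact hm' (by linear_combination -this)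
    · intro i _ hi
      simp [arcStar_apply (by omega : 2 < N + 1), hi]
    · intro h
      simp at h
      omega
  · exact add_mem (Submodule.smul_mem _ _ arcStar_mem)
      (Submodule.smul_mem _ _ (sum_mem fun i _ => Submodule.smul_mem _ _ arcStar_mem))

end Stars

/-! ### The Hecke algebra at roots of unity -/

section Hecke

open Finset

variable {K : Type*} [Field K] {N : ℕ}

/-- The transposition of the neighbouring positions `i` and `i + 1`. -/
def adjSwap (i : Fin N) : Equiv.Perm (Fin (N + 1)) := Equiv.swap i.castSucc i.succ

/-- The generators of the Hecke algebra acting on functions on the symmetric group, by the right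
regular representation. -/
noncomputable def heckeG (r : K) (i : Fin N) : Module.End K (Equiv.Perm (Fin (N + 1)) → K) where
  toFun f w := f (w * adjSwap i) + if w i.succ < w i.castSucc then (r - r⁻¹) * f w else 0
  map_add' f g := by
    ext w
    simp only [Pi.add_apply]
    split_ifs <;> ring
  map_smul' c f := by
    ext w
    simp only [Pi.smul_apply, smul_eq_mul, RingHom.id_apply]
    split_ifs <;> ring

theorem heckeG_apply (r : K) (i : Fin N) (f : Equiv.Perm (Fin (N + 1)) → K)
    (w : Equiv.Perm (Fin (N + 1))) :
    heckeG r i f w =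
      f (w * adjSwap i) + if w i.succ < w i.castSucc then (r - r⁻¹) * f w else 0 := rfl

theorem adjSwap_castSucc (i : Fin N) : adjSwap i i.castSucc = i.succ := Equiv.swap_apply_left _ _

theorem adjSwap_succ (i : Fin N) : adjSwap i i.succ = i.castSucc := Equiv.swap_apply_right _ _

theorem adjSwap_of_ne {i : Fin N} {a : Fin (N + 1)} (h : (a : ℕ) ≠ i) (h' : (a : ℕ) ≠ i + 1) :
    adjSwap i a = a :=
  Equiv.swap_apply_of_ne_of_ne (fun e => h (by simp [e])) (fun e => h' (by simp [e]))

theorem adjSwap_val (i : Fin N) (a : Fin (N + 1)) :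
    (adjSwap i a : ℕ) = if (a : ℕ) = i then (i : ℕ) + 1 else if (a : ℕ) = i + 1 then i else a := by
  split_ifs with h h'
  · rw [show a = i.castSucc from Fin.ext h, adjSwap_castSucc, Fin.val_succ]
  · rw [show a = i.succ from Fin.ext h', adjSwap_succ, Fin.val_castSucc]
  · rw [adjSwap_of_ne h h']

theorem adjSwap_mul_self (i : Fin N) : adjSwap i * adjSwap i = 1 := Equiv.swap_mul_self _ _

theorem mul_adjSwap_mul_adjSwap (w : Equiv.Perm (Fin (N + 1))) (i : Fin N) :
    w * adjSwap i * adjSwap i = w := by rw [mul_assoc, adjSwap_mul_self, mul_one]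

theorem heckeG_sq (r : K) (i : Fin N) :
    heckeG r i ^ 2 + (r⁻¹ - r) • heckeG r i - 1 = 0 := by
  refine LinearMap.ext fun f => funext fun w => ?_
  have hne : w i.castSucc ≠ w i.succ := by simp [Fin.ext_iff]
  simp only [LinearMap.sub_apply, LinearMap.add_apply, LinearMap.smul_apply, pow_two,
    Module.End.mul_apply, Module.End.one_apply, Pi.sub_apply, Pi.add_apply, Pi.smul_apply,
    heckeG_apply, Equiv.Perm.mul_apply, adjSwap_castSucc, adjSwap_succ, mul_adjSwap_mul_adjSwap,
    smul_eq_mul, LinearMap.zero_apply, Pi.zero_apply]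
  rcases lt_or_gt_of_ne hne with h | h
  · simp only [h, h.not_gt, if_true, if_false]; ring
  · simp only [h, h.not_gt, if_true, if_false]; ring

theorem heckeG_comm (r : K) {i j : Fin N} (h : i ≠ j) (h' : ¬ BMWAdj i j) :
    heckeG r i * heckeG r j = heckeG r j * heckeG r i := by
  unfold BMWAdj at h'
  have hij : (i : ℕ) ≠ j := fun e => h (Fin.ext e)
  have hs : adjSwap i * adjSwap j = adjSwap j * adjSwap i := by
    refine Equiv.Perm.Disjoint.commute fun a => ?_
    by_cases ha : (a : ℕ) = i ∨ (a : ℕ) = i + 1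
    · right; exact adjSwap_of_ne (by omega) (by omega)
    · left; exact adjSwap_of_ne (by omega) (by omega)
  refine LinearMap.ext fun f => funext fun w => ?_
  have h₁ : adjSwap i j.succ = j.succ := adjSwap_of_ne (by simp; omega) (by simp; omega)
  have h₂ : adjSwap i j.castSucc = j.castSucc := adjSwap_of_ne (by simp; omega) (by simp; omega)
  have h₃ : adjSwap j i.succ = i.succ := adjSwap_of_ne (by simp; omega) (by simp; omega)
  have h₄ : adjSwap j i.castSucc = i.castSucc := adjSwap_of_ne (by simp; omega) (by simp; omega)
  have h₅ : w * adjSwap i * adjSwap j = w * adjSwap j * adjSwap i := by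
    rw [mul_assoc, hs, ← mul_assoc]
  simp only [Module.End.mul_apply, heckeG_apply, Equiv.Perm.mul_apply, h₁, h₂, h₃, h₄, h₅]
  split_ifs <;> ring

theorem heckeG_braid_succ (r : K) {i j : Fin N} (h : (i : ℕ) + 1 = j) :
    heckeG r i * heckeG r j * heckeG r i = heckeG r j * heckeG r i * heckeG r j := by
  have hji : j.castSucc = i.succ := Fin.ext (by simp [h])
  have e1 : adjSwap i j.succ = j.succ := adjSwap_of_ne (by simp; omega) (by simp; omega)
  have e2 : adjSwap j i.castSucc = i.castSucc := adjSwap_of_ne (by simp; omega) (by simp; omega)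
  have e3 : adjSwap j i.succ = j.succ := hji ▸ adjSwap_castSucc j
  have e4 : adjSwap j j.succ = i.succ := hji ▸ adjSwap_succ j
  have hs : adjSwap i * adjSwap j * adjSwap i = adjSwap j * adjSwap i * adjSwap j := by
    ext a : 1
    simp only [Equiv.Perm.mul_apply]
    rcases (by omega : (a : ℕ) = i ∨ (a : ℕ) = i + 1 ∨ (a : ℕ) = i + 2 ∨
        ((a : ℕ) ≠ i ∧ (a : ℕ) ≠ i + 1 ∧ (a : ℕ) ≠ i + 2)) with ha | ha | ha | ha
    · obtain rfl : a = i.castSucc := Fin.ext (by simp [ha])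
      simp only [adjSwap_castSucc, e1, e2, e3]
    · obtain rfl : a = i.succ := Fin.ext (by simp [ha])
      simp only [adjSwap_castSucc, adjSwap_succ, e1, e2, e3, e4]
    · obtain rfl : a = j.succ := Fin.ext (by simp [ha]; omega)
      simp only [adjSwap_succ, e1, e2, e4]
    · rw [adjSwap_of_ne (i := i) (a := a) (by omega) (by omega),
        adjSwap_of_ne (i := j) (a := a) (by omega) (by omega),
        adjSwap_of_ne (i := i) (a := a) (by omega) (by omega),
        adjSwap_of_ne (i := j) (a := a) (by omega) (by omega)]
  refine LinearMap.ext fun f => funext fun w => ?_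
  have h3 : w * adjSwap i * adjSwap j * adjSwap i = w * adjSwap j * adjSwap i * adjSwap j := by
    simpa only [mul_assoc] using congrArg (w * ·) hs
  simp only [Module.End.mul_apply, heckeG_apply, Equiv.Perm.mul_apply, hji, adjSwap_castSucc,
    adjSwap_succ, e1, e2, e3, e4, mul_adjSwap_mul_adjSwap, h3]
  have n1 : w i.castSucc ≠ w i.succ := by simp [Fin.ext_iff]
  have n2 : w i.succ ≠ w j.succ := by simp [Fin.ext_iff]; omega
  have n3 : w i.castSucc ≠ w j.succ := by simp [Fin.ext_iff]; omega
  rcases lt_or_gt_of_ne n1 with h1 | h1 <;> rcases lt_or_gt_of_ne n2 with h2 | h2 <;>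
    rcases lt_or_gt_of_ne n3 with h3 | h3 <;>
    first
    | (exfalso; omega)
    | (simp only [h1, h2, h3, not_lt_of_gt h1, not_lt_of_gt h2, not_lt_of_gt h3, if_true, if_false]
       try ring)

theorem isBMWFamily_hecke (r l : K) (N : ℕ) :
    IsBMWFamily l (r⁻¹ - r) (fun i : Fin N => heckeG r i) (fun _ => 0) where
  comm i j hne hadj := heckeG_comm r hne hadj
  braid i j hadj := by
    rcases hadj with h | h
    · exact heckeG_braid_succ r h
    · exact (heckeG_braid_succ r h).symm
  e_eq i := by rw [heckeG_sq, smul_zero]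
  g_mul_e i := by simp
  e_g_e i j _ := by simp

/-- The weight `r ^ (number of inversions of w)`, written as a product over pairs of positions. -/
noncomputable def invWeight (r : K) (w : Equiv.Perm (Fin (N + 1))) : K :=
  ∏ p : Fin (N + 1) × Fin (N + 1) with p.1 < p.2, if w p.2 < w p.1 then r else 1

/-- Right multiplication by `adjSwap i` permutes the pairs of positions other than `(i, i + 1)`
without changing their order, and creates one inversion at that pair. -/
theorem invWeight_mul_adjSwap (r : K) {w : Equiv.Perm (Fin (N + 1))} {i : Fin N}
    (h : w i.castSucc < w i.succ) :
    invWeight r (w * adjSwap i) = r * invWeight r w := by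
  have hmem : (i.castSucc, i.succ) ∈
      ({p : Fin (N + 1) × Fin (N + 1) | p.1 < p.2} : Finset _) := by simp
  have key {p : Fin (N + 1) × Fin (N + 1)} (hp : p.1 < p.2) (hne : p ≠ (i.castSucc, i.succ)) :
      adjSwap i p.1 < adjSwap i p.2 ∧ (adjSwap i p.1, adjSwap i p.2) ≠ (i.castSucc, i.succ) := by
    obtain ⟨a, b⟩ := p
    simp only [ne_eq, Prod.mk.injEq, Fin.ext_iff, Fin.lt_def, adjSwap_val, Fin.val_castSucc,
      Fin.val_succ] at hp hne ⊢
    split_ifs <;> omega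
  rw [invWeight, invWeight, ← mul_prod_erase _ _ hmem, ← mul_prod_erase _ _ hmem]
  simp only [Equiv.Perm.mul_apply, adjSwap_castSucc, adjSwap_succ]
  rw [if_pos h, if_neg h.not_gt, one_mul]
  congr 1
  refine prod_nbij' (fun p => (adjSwap i p.1, adjSwap i p.2))
    (fun p => (adjSwap i p.1, adjSwap i p.2)) ?_ ?_ ?_ ?_ ?_
  · intro p hp
    simp only [mem_erase, mem_filter, mem_univ, true_and] at hp ⊢
    exact (key hp.2 hp.1).symm
  · intro p hp
    simp only [mem_erase, mem_filter, mem_univ, true_and] at hp ⊢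
    exact (key hp.2 hp.1).symm
  · intro p _
    simp [← Equiv.Perm.mul_apply, adjSwap_mul_self]
  · intro p _
    simp [← Equiv.Perm.mul_apply, adjSwap_mul_self]
  · intro p _
    rfl

theorem invWeight_one (r : K) : invWeight r (1 : Equiv.Perm (Fin (N + 1))) = 1 := by
  refine prod_eq_one fun p hp => ?_
  rw [mem_filter] at hp
  exact if_neg hp.2.not_gt

theorem heckeG_invWeight {r : K} (hr : r ≠ 0) (i : Fin N) :
    heckeG r i (invWeight r) = r • invWeight r := by
  funext w
  have hne : w i.castSucc ≠ w i.succ := by simp [Fin.ext_iff]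
  rw [heckeG_apply, Pi.smul_apply, smul_eq_mul]
  rcases lt_or_gt_of_ne hne with h | h
  · rw [if_neg h.not_gt, invWeight_mul_adjSwap r h, add_zero]
  · have h' : (w * adjSwap i) i.castSucc < (w * adjSwap i) i.succ := by
      simpa only [Equiv.Perm.mul_apply, adjSwap_castSucc, adjSwap_succ] using h
    have := invWeight_mul_adjSwap r h'
    rw [mul_adjSwap_mul_adjSwap] at this
    rw [if_pos h, this]
    field_simp
    ring

theorem heckeG_single {r : K} {w : Equiv.Perm (Fin (N + 1))} {i : Fin N}
    (h : w i.castSucc < w i.succ) :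
    heckeG r i (Pi.single w 1) = Pi.single (w * adjSwap i) 1 := by
  funext v
  have hv : v * adjSwap i = w ↔ v = w * adjSwap i :=
    ⟨fun e => by rw [← e, mul_adjSwap_mul_adjSwap], fun e => by rw [e, mul_adjSwap_mul_adjSwap]⟩
  rw [heckeG_apply]
  simp only [Pi.single_apply, hv]
  by_cases hvw : v = w
  · subst hvw
    simp [h.not_gt]
  · simp [hvw]

/-- If right multiplication by a transposition of neighbours that creates an inversion scales `F`
by `q`, then the sum of `F` vanishes as soon as `1 + q + ⋯ + q ^ (k - 1) = 0` for some
`1 ≤ k ≤ N + 1`: split the sum according to the position of the least of the first `k` values. -/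
theorem sum_perm_eq_zero {q : K} {F : Equiv.Perm (Fin (N + 1)) → K}
    (hF : ∀ w (i : Fin N), w i.castSucc < w i.succ → F (w * adjSwap i) = q * F w)
    {k : ℕ} (hk : 1 ≤ k) (hkN : k ≤ N + 1) (hq : ∑ j ∈ range k, q ^ j = 0) :
    ∑ w, F w = 0 := by
  -- `T i` is the sum over the `w` whose least value on the first `k` positions occurs at `i`.
  set T : Fin (N + 1) → K := fun i =>
    ∑ w : Equiv.Perm (Fin (N + 1)) with ∀ a : Fin (N + 1), (a : ℕ) < k → w i ≤ w a, F w with hT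
  have hstep : ∀ i : Fin N, (i : ℕ) + 1 < k → T i.succ = q * T i.castSucc := by
    intro i hi
    simp only [hT]
    rw [mul_sum]
    symm
    refine sum_nbij' (fun w => w * adjSwap i) (fun w => w * adjSwap i) ?_ ?_
      (fun w _ => mul_adjSwap_mul_adjSwap w i) (fun w _ => mul_adjSwap_mul_adjSwap w i) ?_
    · intro w hw
      simp only [mem_filter, mem_univ, true_and, Equiv.Perm.mul_apply, adjSwap_succ] at hw ⊢
      refine fun a ha => hw _ ?_
      rw [adjSwap_val]
      split_ifs <;> omega
    · intro w hw
      simp only [mem_filter, mem_univ, true_and, Equiv.Perm.mul_apply, adjSwap_castSucc] at hw ⊢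
      refine fun a ha => hw _ ?_
      rw [adjSwap_val]
      split_ifs <;> omega
    · intro w hw
      simp only [mem_filter, mem_univ, true_and] at hw
      refine (hF w i (lt_of_le_of_ne (hw i.succ (by simpa using hi)) ?_)).symm
      simp [Fin.ext_iff]
  have hpow : ∀ i : Fin (N + 1), (i : ℕ) < k → T i = q ^ (i : ℕ) * T 0 := by
    intro i
    induction i using Fin.induction with
    | zero => intro _; simp
    | succ i ih =>
      intro hi
      rw [Fin.val_succ] at hi
      rw [hstep i hi, ih (by rw [Fin.val_castSucc]; omega), Fin.val_succ, Fin.val_castSucc]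
      ring
  have hsplit : ∑ w, F w = ∑ i ∈ univ.filter (fun i : Fin (N + 1) => (i : ℕ) < k), T i := by
    simp only [hT, sum_filter (fun w : Equiv.Perm (Fin (N + 1)) => _)]
    rw [sum_comm]
    refine sum_congr rfl fun w _ => ?_
    obtain ⟨i, hi, hmin⟩ := exists_min_image (univ.filter fun i : Fin (N + 1) => (i : ℕ) < k) w
      ⟨0, by simp; omega⟩
    simp only [mem_filter, mem_univ, true_and] at hi hmin
    rw [sum_eq_single i]
    · rw [if_pos hmin]
    · intro j hj hji
      rw [mem_filter] at hj
      refine if_neg fun h => hji (w.injective (le_antisymm (h i hi) (hmin j hj.2)))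
    · intro h
      exact absurd (by simpa using hi) h
  rw [hsplit, sum_congr rfl (fun i hi => hpow i (mem_filter.mp hi).2), ← sum_mul, sum_filter,
    Fin.sum_univ_eq_sum_range (fun j => if j < k then q ^ j else 0), ← sum_filter]
  have : (range (N + 1)).filter (· < k) = range k := by
    ext j
    simp only [mem_filter, mem_range]
    omega
  rw [this, hq, zero_mul]

/-- At a root of unity the Hecke algebra quotient is not semisimple: a projection onto the line of
`invWeight r` would give a linear form taking the value `1` there, but equivariance forces this
value to be a multiple of the Poincaré polynomial of the symmetric group at `r ^ 2`. -/
theorem not_isSemisimpleRing_of_pow_eq_one {l r : K} (hl : l ≠ 0) (hr : r ≠ 0)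
    (hm : r⁻¹ - r ≠ 0) {k : ℕ} (hk : 1 ≤ k) (hkN : k ≤ N + 1) (hrk : r ^ (2 * k) = 1) :
    ¬ IsSemisimpleRing (RingQuot (BMWRel K l (r⁻¹ - r) N)) := by
  intro hss
  set u : Equiv.Perm (Fin (N + 1)) → K := invWeight r with hu
  obtain ⟨p, hpU, hp, hpg, -⟩ := (isBMWFamily_hecke r l N).exists_projection hl hm hss (K ∙ u)
    (fun i v hv => by
      obtain ⟨c, rfl⟩ := Submodule.mem_span_singleton.mp hv
      rw [map_smul, heckeG_invWeight hr]
      exact Submodule.smul_mem _ _ (Submodule.smul_mem _ _ (Submodule.mem_span_singleton_self u)))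
    (fun i v hv => by simp)
  have hpr : ∀ i v, p (heckeG r i v) 1 = r * p v 1 := by
    intro i v
    obtain ⟨c, hc⟩ := Submodule.mem_span_singleton.mp (hpU v)
    rw [hpg, ← hc, map_smul, heckeG_invWeight hr, smul_comm]
    rfl
  have hone : p u 1 = 1 := by
    rw [hp u (Submodule.mem_span_singleton_self u), hu, invWeight_one]
  have hsum : p u 1 = ∑ w, u w * p (Pi.single w 1) 1 := by
    conv_lhs => rw [pi_eq_sum_univ' u]
    simp [map_sum, Finset.sum_apply]
  rw [hsum, sum_perm_eq_zero (q := r ^ 2) _ hk hkN] at hone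
  · exact zero_ne_one hone
  · have h := geom_sum_mul (r ^ 2) k
    rw [← pow_mul, hrk, sub_self] at h
    refine (mul_eq_zero.mp h).resolve_right fun h' => hm ?_
    field_simp
    linear_combination -h'
  · intro w i hw
    rw [← heckeG_single hw, hpr, hu, invWeight_mul_adjSwap r hw]
    ring

end Hecke

/-! ### The parameters -/

section Parameters

variable {K : Type*} [Field K] {l r : K}

/-- The parameters at which a subrepresentation of the arc module exists, for one of the two
choices `r`, `-r⁻¹` of a root of `x ^ 2 + m x - 1`. -/
theorem not_isSemisimpleRing_of_param (hl : l ≠ 0) (hr : r ≠ 0) (hm : r⁻¹ - r ≠ 0) {n : ℕ}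
    (hn : 3 ≤ n)
    (h : (4 ≤ n ∧ l = r) ∨ l = -r ^ 3 ∨ l ^ 2 * (r ^ (n - 3)) ^ 2 = 1 ∨ l * r ^ (2 * n - 3) = 1) :
    ¬ IsSemisimpleRing (RingQuot (BMWRel K l (r⁻¹ - r) (n - 1))) := by
  obtain ⟨t, rfl⟩ : ∃ t, n = t + 3 := ⟨n - 3, by omega⟩
  have e1 : t + 3 - 1 = t + 2 := rfl
  have e2 : 2 * (t + 3) - 3 = 2 * t + 3 := by omega
  have hX : (r ^ 2) ^ (t + 2 + 1) * r⁻¹ ^ 3 = r ^ (2 * t + 3) := by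
    field_simp
    ring
  rw [e1]
  rcases h with ⟨h4, h⟩ | h | h | h
  · exact not_isSemisimpleRing_of_eq hr hm h (by omega)
  · exact not_isSemisimpleRing_of_eq_neg_cube hr hm h (by omega)
  · refine not_isSemisimpleRing_of_star hl hr hm (by omega) ?_
    rw [hX]
    rw [Nat.add_sub_cancel] at h
    have : l ^ 2 * r ^ (2 * t + 3) - r ^ 3 = 0 := by linear_combination r ^ 3 * h
    rw [this, zero_mul]
  · refine not_isSemisimpleRing_of_star hl hr hm (by omega) ?_
    rw [hX, ← e2, h, sub_self, mul_zero]

/-- The same for the other root: the conditions are those above with `-r⁻¹` in place of `r`. -/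
theorem not_isSemisimpleRing_of_param_dual (hl : l ≠ 0) (hr : r ≠ 0) (hm : r⁻¹ - r ≠ 0) {n : ℕ}
    (hn : 3 ≤ n)
    (h : (4 ≤ n ∧ l = -r⁻¹) ∨ l = r⁻¹ ^ 3 ∨ l ^ 2 = (r ^ (n - 3)) ^ 2 ∨ l = -r ^ (2 * n - 3)) :
    ¬ IsSemisimpleRing (RingQuot (BMWRel K l (r⁻¹ - r) (n - 1))) := by
  have hr' : -r⁻¹ ≠ 0 := neg_ne_zero.mpr (inv_ne_zero hr)
  have hmm : (-r⁻¹)⁻¹ - -r⁻¹ = r⁻¹ - r := by rw [inv_neg, inv_inv]; ring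
  have key := not_isSemisimpleRing_of_param (r := -r⁻¹) hl hr' (hmm ▸ hm) hn
  rw [hmm] at key
  refine key ?_
  rcases h with h | h | h | h
  · exact Or.inl h
  · exact Or.inr (Or.inl (by rw [h]; ring))
  · refine Or.inr (Or.inr (Or.inl ?_))
    rw [h, ← pow_mul, ← pow_mul, mul_comm (n - 3), pow_mul, pow_mul, ← mul_pow]
    have : r ^ 2 * (-r⁻¹) ^ 2 = 1 := by field_simp
    rw [this, one_pow]
  · refine Or.inr (Or.inr (Or.inr ?_))
    have hodd : Odd (2 * n - 3) := ⟨n - 2, by omega⟩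
    rw [h, hodd.neg_pow, neg_mul_neg, ← mul_pow, mul_inv_cancel₀ hr, one_pow]

theorem not_isSemisimpleRing_bmw {m : K} (hl : l ≠ 0) (hm : m ≠ 0) (hr : r ≠ 0)
    (hmr : m = r⁻¹ - r) {n : ℕ} (hn : 3 ≤ n)
    (h : (∃ k, 2 ≤ k ∧ k ≤ n ∧ r ^ (2 * k) = 1) ∨ (4 ≤ n ∧ (l = r ∨ l = -r⁻¹)) ∨
      l = -r ^ 3 ∨ l = r⁻¹ ^ 3 ∨ l ^ 2 * (r ^ (n - 3)) ^ 2 = 1 ∨ l ^ 2 = (r ^ (n - 3)) ^ 2 ∨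
      l * r ^ (2 * n - 3) = 1 ∨ l = -r ^ (2 * n - 3)) :
    ¬ IsSemisimpleRing (BMWAlgebra K l m n) := by
  subst hmr
  have h1 := not_isSemisimpleRing_of_param hl hr hm hn
  have h2 := not_isSemisimpleRing_of_param_dual hl hr hm hn
  rcases h with ⟨k, hk, hkn, hrk⟩ | h
  · exact not_isSemisimpleRing_of_pow_eq_one hl hr hm (by omega) (by omega) hrk
  · tauto

end Parameters

theorem theorem2 (l m r : ℂ) (hl : l ≠ 0) (hm : m ≠ 0) (hr : r ≠ 0) (hmr : m = 1 / r - r) :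
    (∀ n : ℕ, 4 ≤ n →
      ((∃ k : ℕ, 2 ≤ k ∧ k ≤ n ∧ r ^ (2 * k) = 1) ∨
        l ∈ ({r, -r ^ 3, 1 / r ^ (n - 3), -(1 / r ^ (n - 3)), 1 / r ^ (2 * n - 3),
          -r ^ (2 * n - 3), r ^ (n - 3), -r ^ (n - 3), 1 / r ^ 3, -(1 / r)} : Set ℂ)) →
      ¬ IsSemisimpleRing
        (BMWAlgebra (paramField l r) ⟨l, l_mem_paramField l r⟩ ⟨m, m_mem_paramField hmr⟩ n)) ∧
    ((r ^ 4 = 1 ∨ r ^ 6 = 1 ∨ l ∈ ({-r ^ 3, 1 / r ^ 3, 1, -1} : Set ℂ)) →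
      ¬ IsSemisimpleRing
        (BMWAlgebra (paramField l r) ⟨l, l_mem_paramField l r⟩ ⟨m, m_mem_paramField hmr⟩ 3)) := by
  have hbmw := @not_isSemisimpleRing_bmw (paramField l r) _ ⟨l, l_mem_paramField l r⟩
    ⟨r, r_mem_paramField l r⟩ ⟨m, m_mem_paramField hmr⟩
    (fun h => hl (congrArg Subtype.val h)) (fun h => hm (congrArg Subtype.val h))
    (fun h => hr (congrArg Subtype.val h)) (Subtype.ext (by simpa using hmr))
  simp only [Subtype.ext_iff, IntermediateField.coe_pow, IntermediateField.coe_mul,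
    IntermediateField.coe_neg, IntermediateField.coe_inv, IntermediateField.coe_one] at hbmw
  simp only [Set.mem_insert_iff, Set.mem_singleton_iff]
  refine ⟨fun n hn h => hbmw (by omega) ?_, fun h => hbmw le_rfl ?_⟩
  · have hp : r ^ (n - 3) ≠ 0 := pow_ne_zero _ hr
    have hp' : r ^ (2 * n - 3) ≠ 0 := pow_ne_zero _ hr
    rcases h with h | h | h | h | h | h | h | h | h | h | h
    · exact Or.inl h
    · tauto
    · tauto
    · have : l ^ 2 * (r ^ (n - 3)) ^ 2 = 1 := by rw [h]; field_simp
      tauto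
    · have : l ^ 2 * (r ^ (n - 3)) ^ 2 = 1 := by rw [h]; field_simp
      tauto
    · have : l * r ^ (2 * n - 3) = 1 := by rw [h]; field_simp
      tauto
    · tauto
    · have : l ^ 2 = (r ^ (n - 3)) ^ 2 := by rw [h]
      tauto
    · have : l ^ 2 = (r ^ (n - 3)) ^ 2 := by rw [h]; ring
      tauto
    · have : l = r⁻¹ ^ 3 := by rw [h]; field_simp
      tauto
    · have : l = -r⁻¹ := by rw [h]; field_simp
      tauto
  · rcases h with h | h | h | h | h | h
    · exact Or.inl ⟨2, le_rfl, by omega, h⟩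
    · exact Or.inl ⟨3, by omega, le_rfl, h⟩
    · tauto
    · have : l = r⁻¹ ^ 3 := by rw [h]; field_simp
      tauto
    · have : l ^ 2 = (r ^ (3 - 3)) ^ 2 := by rw [h]; simp
      tauto
    · have : l ^ 2 = (r ^ (3 - 3)) ^ 2 := by rw [h]; simp
      tauto
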